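/- Let $\Lambda\in\mathbb{R}^{2\times2}$ be symmetric positive definite, $\theta\ge 0$, $\Sigma\in C^0(\mathbb{R}^2;\mathbb{R}^{2\times 2})$, $H\in\mathbb{R}^{2\times2}$ symmetric and invertible, $K_1\in C^0([0,1];\mathbb{R}^{2\times2})$ with symmetric invertible values, $K_2,K_3\in C^0([0,1];\mathbb{R}^{2\times2})$, $K_4\in\mathbb{R}^{2\times2}$, and suppose that $\mathscr{Q}(\xi):=K_1(\xi)H^{-1}$ is symmetric and positive definite for every $\xi\in[0,1]$. Write $L^2:=L^2((0,1);\mathbb{R}^2)$, $\mathscr{K}_i\zeta:=\int_0^1K_i(\xi)\zeta(\xi)\,d\xi$ for $i=1,2$, $\mathscr{K}_3\zeta:=\int_0^1K_3(\xi)\zeta(\xi)\,d\xi+K_4\zeta(1)$, and let $\mathscr{A}\zeta:=-\Lambda\zeta'+\mathscr{K}_3\zeta$ with domain $\mathscr{D}(\mathscr{A}):=\{\zeta\in H^1((0,1);\mathbb{R}^2):\zeta(0)=0\}$. Assume: (i) for some $\omega>0$, $\langle\mathscr{A}\zeta,\mathscr{Q}\zeta\rangle_{L^2}\le-\omega\|\zeta\|_{L^2}^2$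 for all $\zeta\in\mathscr{D}(\mathscr{A})$; (ii) $\int_0^1\zeta(\xi)^{\mathrm T}\mathscr{Q}(\xi)\Sigma(y)\bigl[\zeta(\xi)+\mathscr{K}_2\zeta\bigr]\,d\xi\le0$ for all $y\in\mathbb{R}^2$ and $\zeta\in L^2$, and $\Sigma$ is globally Lipschitz continuous. Consider the semilinear transport equation $$\partial_t z+\Lambda\,\partial_\xi z=\theta\,\Sigma(v(t))\bigl[z+\mathscr{K}_2z\bigr]+\mathscr{K}_3z+Hv(t),\qquad z(0,t)=0,\qquad z(\cdot,0)=z_0,$$ with input $v$ and output $F(t):=\mathscr{K}_1z(\cdot,t)$. A mild solution on $[0,T]$ is a function $z\in C^0([0,T];L^2)$ that satisfies the variation of constants formula $z(t)=S(t)z_0+\int_0^tS(t-s)\bigl(\theta\Sigma(v(s))[z(s)+\mathscr{K}_2z(s)]+Hv(s)\bigr)ds$ for $t\in[0,T]$, where $S$ is the $C_0$-semigroup on $L^2$ generated by $\mathscr{A}$. Then for all $T>0$, $z_0\in L^2$ and $v\in C^0([0,T];\mathbb{R}^2)$ a mild solution on $[0,T]$ exists, and the system is strictly passive with storage function $$V(\zeta):=\tfrac12\int_0^1\zeta(\xi)^{\mathrm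 T}\mathscr{Q}(\xi)\zeta(\xi)\,d\xi .$$ That is, $V\ge0$, $V(0)=0$, and for all $T>0$, $z_0\in L^2$, $v\in C^0([0,T];\mathbb{R}^2)$, every mild solution $z$ on $[0,T]$ satisfies $$\int_0^tF(t')^{\mathrm T}v(t')\,dt'\;\ge\;V(z(\cdot,t))-V(z_0)+\omega\int_0^t\|z(\cdot,t')\|_{L^2}^2\,dt',\qquad t\in[0,T],$$ with the same $\omega$ as in (i). -/

import Mathlib

open MeasureTheory Set Filter Topology
open scoped NNReal

noncomputable section

namespace TirePDE

/-- `ℝ²` with the Euclidean norm. -/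
abbrev R2 : Type := EuclideanSpace ℝ (Fin 2)

abbrev M2 : Type := Matrix (Fin 2) (Fin 2) ℝ

/-- Lebesgue measure on `(0,1)`. -/
abbrev μI : Measure ℝ := volume.restrict (Ioo (0 : ℝ) 1)

/-- The Hilbert space `L²((0,1); ℝ²)`. -/
abbrev L2 : Type := Lp R2 2 μI

/-- The action of a matrix on `ℝ²`, as a continuous linear map. -/
abbrev act (M : M2) : R2 →L[ℝ] R2 := Matrix.toEuclideanCLM (n := Fin 2) (𝕜 := ℝ) M

/-- `g ∈ L²` is the weak derivative of `ζ ∈ L²` on `(0,1)`. Hence `ζ ∈ H¹((0,1); ℝ²)` if and only if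
`∃ g, HasWeakDeriv ζ g`. -/
def HasWeakDeriv (ζ g : L2) : Prop :=
  ∀ φ : ℝ → ℝ, ContDiff ℝ ((⊤ : ℕ∞) : WithTop ℕ∞) φ → HasCompactSupport φ → tsupport φ ⊆ Ioo 0 1 →
    ∫ ξ in Ioo (0 : ℝ) 1, deriv φ ξ • ζ ξ = -∫ ξ in Ioo (0 : ℝ) 1, φ ξ • g ξ

/-- `w` is the continuous representative on `[0,1]` of `ζ`; the point values `ζ(0)`, `ζ(1)` of an
`H¹` function are those of `w`. -/
def IsContRep (ζ : L2) (w : ℝ → R2) : Prop :=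
  ContinuousOn w (Icc 0 1) ∧ ζ =ᵐ[μI] w

/-- The bounded functional `ζ ↦ ∫₀¹ K(ξ) ζ(ξ) dξ`. -/
def kernelInt (K : ℝ → M2) (ζ : L2) : R2 := ∫ ξ in Ioo (0 : ℝ) 1, act (K ξ) (ζ ξ)

/-- The coefficients of the transport equation
`z_t + Λ z_ξ = θ Σ(v) [z + 𝒦₂ z] + 𝒦₃ z + H v`, `z(0,t) = 0`, with output `F = 𝒦₁ z`, where
`𝒦ᵢ ζ = ∫₀¹ Kᵢ ζ` for `i = 1, 2` and `𝒦₃ ζ = ∫₀¹ K₃ ζ + K₄ ζ(1)`,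
and the standing properties of these coefficients. -/
structure TransportSystem where
  /-- transport velocities (positive definite includes symmetric) -/
  Λ : M2
  posDef_Λ : Λ.PosDef
  θ : ℝ
  θ_nonneg : 0 ≤ θ
  /-- the nonlinear source matrix `Σ` -/
  Sig : R2 → M2
  continuous_Sig : Continuous Sig
  H : M2
  isUnit_H : IsUnit H
  isSymm_H : H.IsSymm
  K₁ : ℝ → M2
  continuousOn_K₁ : ContinuousOn K₁ (Icc 0 1)
  isUnit_K₁ : ∀ ξ ∈ Icc (0 : ℝ) 1, IsUnit (K₁ ξ)
  isSymm_K₁ : ∀ ξ ∈ Icc (0 : ℝ) 1, (K₁ ξ).IsSymm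
  K₂ : ℝ → M2
  continuousOn_K₂ : ContinuousOn K₂ (Icc 0 1)
  K₃ : ℝ → M2
  continuousOn_K₃ : ContinuousOn K₃ (Icc 0 1)
  K₄ : M2
  /-- `𝒬(ξ) = K₁(ξ) H⁻¹` is symmetric and positive definite -/
  posDef_Q : ∀ ξ ∈ Icc (0 : ℝ) 1, (K₁ ξ * H⁻¹).PosDef

namespace TransportSystem

variable (P : TransportSystem)

/-- `𝒬(ξ) = K₁(ξ) H⁻¹`. -/
def Q (ξ : ℝ) : M2 := P.K₁ ξ * P.H⁻¹

/-- The graph of the unbounded operator `𝒜` on `L²`: `P.IsA ζ η` says that `ζ ∈ 𝒟(𝒜)`, that is,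
`ζ ∈ H¹` and `ζ(0) = 0`, and that `η = 𝒜 ζ = -Λ ζ' + ∫₀¹ K₃ ζ + K₄ ζ(1)`. -/
def IsA (ζ η : L2) : Prop :=
  ∃ (g : L2) (w : ℝ → R2), HasWeakDeriv ζ g ∧ IsContRep ζ w ∧ w 0 = 0 ∧
    η =ᵐ[μI] fun ξ => -act P.Λ (g ξ) + (kernelInt P.K₃ ζ + act P.K₄ (w 1))

/-- Strict dissipativity: `⟨𝒜 ζ, 𝒬 ζ⟩ ≤ -ω ‖ζ‖²` for all `ζ ∈ 𝒟(𝒜)`. -/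
def StrictDissipativity (ω : ℝ) : Prop :=
  ∀ ζ η : L2, P.IsA ζ η →
    ∫ ξ in Ioo (0 : ℝ) 1, inner ℝ (η ξ) (act (P.Q ξ) (ζ ξ)) ≤ -ω * ‖ζ‖ ^ 2

/-- `∫₀¹ ζᵀ 𝒬 Σ(y) [ζ + 𝒦₂ ζ] ≤ 0` for all `y ∈ ℝ²` and `ζ ∈ L²`. -/
def SourceDissipativity : Prop :=
  ∀ (y : R2) (ζ : L2),
    ∫ ξ in Ioo (0 : ℝ) 1,
      inner ℝ (ζ ξ) (act (P.Q ξ) (act (P.Sig y) (ζ ξ + kernelInt P.K₂ ζ))) ≤ 0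

/-- `Σ` is globally Lipschitz continuous (with the operator norm on matrices). -/
def SourceLipschitz : Prop :=
  ∃ L : ℝ≥0, ∀ y₁ y₂ : R2, ‖act (P.Sig y₁ - P.Sig y₂)‖ ≤ L * ‖y₁ - y₂‖

/-- The semilinear term `θ Σ(y) [ζ + 𝒦₂ ζ] + H y ∈ L²`. -/
def source (y : R2) (ζ : L2) : L2 :=
  P.θ • (act (P.Sig y)).compLp (ζ + Lp.const 2 μI (kernelInt P.K₂ ζ)) + Lp.const 2 μI (act P.H y)

end TransportSystem

/-- `S` (restricted to `t ≥ 0`) is a `C₀`-semigroup of bounded operators. -/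
structure IsC0Semigroup (S : ℝ → L2 →L[ℝ] L2) : Prop where
  zero : S 0 = ContinuousLinearMap.id ℝ L2
  add : ∀ s t : ℝ, 0 ≤ s → 0 ≤ t → S (s + t) = (S s).comp (S t)
  continuousOn : ∀ ζ : L2, ContinuousOn (fun t => S t ζ) (Ici 0)

/-- The operator with graph `A` is the infinitesimal generator of `S`. -/
def IsGenerator (A : L2 → L2 → Prop) (S : ℝ → L2 →L[ℝ] L2) : Prop :=
  ∀ ζ η : L2, A ζ η ↔ Tendsto (fun t : ℝ => t⁻¹ • (S t ζ - ζ)) (𝓝[>] 0) (𝓝 η)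

namespace TransportSystem

variable (P : TransportSystem)

/-- `z` is a mild solution on `[0,T]` of `ż = 𝒜 z + θ Σ(v) [z + 𝒦₂ z] + H v`, `z(0) = z₀`:
it is continuous into `L²` and satisfies the variation of constants formula with the
`C₀`-semigroup generated by `𝒜`. -/
def IsMildSolution (T : ℝ) (z₀ : L2) (v : ℝ → R2) (z : ℝ → L2) : Prop :=
  ContinuousOn z (Icc 0 T) ∧
    ∃ S : ℝ → L2 →L[ℝ] L2, IsC0Semigroup S ∧ IsGenerator P.IsA S ∧
      ∀ t ∈ Icc 0 T, z t = S t z₀ + ∫ s in (0 : ℝ)..t, S (t - s) (P.source (v s) (z s))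

/-- The output `F = 𝒦₁ z`. -/
def output (ζ : L2) : R2 := kernelInt P.K₁ ζ

/-- `V(ζ) = ½ ∫₀¹ ζᵀ 𝒬 ζ`. -/
def storage (ζ : L2) : ℝ :=
  (1 / 2) * ∫ ξ in Ioo (0 : ℝ) 1, inner ℝ (ζ ξ) (act (P.Q ξ) (ζ ξ))

/-- The system with input `v` and output `F = 𝒦₁ z` is strictly passive, with storage function `V`
and dissipation rate `ω ‖·‖²`. -/
structure IsStrictlyPassive (V : L2 → ℝ) (ω : ℝ) : Prop where
  rate_pos : 0 < ω
  storage_nonneg : ∀ ζ, 0 ≤ V ζ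
  storage_zero : V 0 = 0
  passivity : ∀ (T : ℝ) (z₀ : L2) (v : ℝ → R2) (z : ℝ → L2), 0 < T →
    ContinuousOn v (Icc 0 T) → P.IsMildSolution T z₀ v z → ∀ t ∈ Icc 0 T,
      ∫ s in (0 : ℝ)..t, inner ℝ (P.output (z s)) (v s) ≥
        V (z t) - V z₀ + ω * ∫ s in (0 : ℝ)..t, ‖z s‖ ^ 2

end TransportSystem

end TirePDE

end

/-! The proof works in the equivalent inner product `⟪x, B y⟫` on `L²`, where `B` is multiplication
by `𝒬`, so that twice the storage function is the energy `E(ζ) = ⟪ζ, B ζ⟫`. Hypothesis (i) says that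
`𝒜` is strictly dissipative for it. The equation `lζ - 𝒜ζ = f` is a linear ODE in `ξ` once the
nonlocal term `𝒦₃ζ` is replaced by an unknown constant. Closing the loop is a linear problem in
`ℝ²`, solvable because dissipativity makes it injective (`exists_sub_feedback_eq`, `isA_surj`).
Lumer-Phillips, proved through Yosida approximations (`IsMaxDissipative.exists_semigroup`), then
yields the semigroup. For fixed `v` the source is affine in the state, with a Lipschitz constant
uniform on `[0,T]`, so a contraction in an exponentially weighted sup norm gives mild solutions
(`exists_eq_duhamel`).

For passivity, a mild solution satisfies `z(t+h) = S(h) z(t) + q(h)` with `q(h)/h → f(t)`. Together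
with the energy inequality for `S`, extended from the domain by density, this bounds the right slope
of `E(z(t))` by `-2ω‖z‖² + 2⟪f, B z⟫`. A comparison principle integrates the bound without any
differentiability of `z` (`energy_duhamel_le`). Finally `⟪f, B z⟫ ≤ ⟪F, v⟫`: the `Σ` part is
nonpositive by (ii), and `𝒬H = K₁` turns the input part into the supply rate (`inner_source_le`). -/

namespace TirePDE

/-! ### Weighted inner products and maximal dissipative operators. -/

section Abstract

variable {X : Type*} [NormedAddCommGroup X] [InnerProductSpace ℝ X]

/-- `B` is a bounded symmetric coercive operator, so that `⟪x, B y⟫` is an equivalent inner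
product. -/
structure IsInnerWeight (B : X →L[ℝ] X) : Prop where
  symm : ∀ x y, inner ℝ (B x) y = inner ℝ x (B y)
  coercive : ∃ c : ℝ, 0 < c ∧ ∀ x, c * ‖x‖ ^ 2 ≤ inner ℝ x (B x)

/-- The linear operator with graph `A` is dissipative for the inner product with weight `B`, and `l - A` is
onto for all `l > 0`. -/
structure IsMaxDissipative (B : X →L[ℝ] X) (A : X → X → Prop) : Prop where
  add : ∀ x y x' y', A x y → A x' y' → A (x + x') (y + y')
  smul : ∀ (a : ℝ) x y, A x y → A (a • x) (a • y)
  dissip : ∀ x y, A x y → inner ℝ y (B x) ≤ 0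
  single : ∀ y, A 0 y → y = 0
  surj : ∀ l : ℝ, 0 < l → ∀ f, ∃ x, A x (l • x - f)

namespace IsInnerWeight

variable {B : X →L[ℝ] X}

theorem energy_nonneg (hB : IsInnerWeight B) (x : X) : 0 ≤ inner ℝ x (B x) := by
  obtain ⟨c, hc, h⟩ := hB.coercive
  exact le_trans (by positivity) (h x)

theorem eq_zero_of_energy_nonpos (hB : IsInnerWeight B) {x : X} (hx : inner ℝ x (B x) ≤ 0) : x = 0 := by
  obtain ⟨c, hc, h⟩ := hB.coercive
  have h1 : ‖x‖ ^ 2 ≤ 0 := by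
    by_contra! h2
    nlinarith [h x]
  simpa using le_antisymm h1 (sq_nonneg _)

/-- Turns every energy comparison into a norm bound. The `+ 1` in the constant only secures `1 ≤ M`.
-/
theorem exists_norm_le (hB : IsInnerWeight B) : ∃ M : ℝ, 1 ≤ M ∧
    ∀ x u : X, inner ℝ u (B u) ≤ inner ℝ x (B x) → ‖u‖ ≤ M * ‖x‖ := by
  obtain ⟨c, hc, h⟩ := hB.coercive
  refine ⟨√(‖B‖ / c) + 1, by linarith [Real.sqrt_nonneg (‖B‖ / c)], fun x u hu => ?_⟩
  have h1 : inner ℝ x (B x) ≤ ‖B‖ * ‖x‖ ^ 2 := by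
    calc inner ℝ x (B x) ≤ ‖x‖ * ‖B x‖ := real_inner_le_norm _ _
      _ ≤ ‖x‖ * (‖B‖ * ‖x‖) := by gcongr; exact B.le_opNorm x
      _ = _ := by ring
  have h2 : ‖u‖ ^ 2 ≤ (√(‖B‖ / c) * ‖x‖) ^ 2 := by
    rw [mul_pow, Real.sq_sqrt (by positivity), div_mul_eq_mul_div, le_div_iff₀ hc]
    linarith [h u]
  have h3 := abs_le_of_sq_le_sq h2 (by positivity)
  rw [abs_norm] at h3
  nlinarith [norm_nonneg x]

/-- Cauchy-Schwarz for the weighted inner product, in arithmetic form. -/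
theorem two_mul_inner_le (hB : IsInnerWeight B) (x y : X) :
    2 * inner ℝ x (B y) ≤ inner ℝ x (B x) + inner ℝ y (B y) := by
  have h := hB.energy_nonneg (x - y)
  simp only [map_sub, inner_sub_left, inner_sub_right] at h
  have h1 : inner ℝ y (B x) = inner ℝ x (B y) := by
    rw [← hB.symm, real_inner_comm]
  linarith

theorem energy_add (hB : IsInnerWeight B) (x y : X) : inner ℝ (x + y) (B (x + y)) =
    inner ℝ x (B x) + 2 * inner ℝ y (B x) + inner ℝ y (B y) := by
  have h1 : inner ℝ x (B y) = inner ℝ y (B x) := by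
    rw [← hB.symm, real_inner_comm]
  simp only [map_add, inner_add_left, inner_add_right]
  linarith

theorem hasDerivWithinAt_energy (hB : IsInnerWeight B) {u : ℝ → X} {u' : X} {s : Set ℝ} {t : ℝ}
    (hu : HasDerivWithinAt u u' s t) :
    HasDerivWithinAt (fun t => inner ℝ (u t) (B (u t))) (2 * inner ℝ u' (B (u t))) s t := by
  have h := hu.inner ℝ (B.hasFDerivAt.comp_hasDerivWithinAt t hu)
  have h1 : inner ℝ (u t) (B u') = inner ℝ u' (B (u t)) := by
    rw [← hB.symm, real_inner_comm]
  rw [h1] at h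
  rw [two_mul]
  exact h

/-- Lax-Milgram for the coercive form `⟪B u, v⟫`. -/
theorem exists_apply_eq [CompleteSpace X] (hB : IsInnerWeight B) (y : X) : ∃ x, B x = y := by
  obtain ⟨c, hc, h⟩ := hB.coercive
  have hco : IsCoercive ((innerSL ℝ (E := X)).comp B) := by
    refine ⟨c, hc, fun u => ?_⟩
    have := h u
    simp only [ContinuousLinearMap.comp_apply, innerSL_apply_apply]
    rw [hB.symm]
    linarith
  refine ⟨hco.continuousLinearEquivOfBilin.symm y, ?_⟩
  refine ext_inner_right ℝ fun v => ?_
  have := hco.continuousLinearEquivOfBilin_apply (hco.continuousLinearEquivOfBilin.symm y) v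
  simpa using this.symm

end IsInnerWeight

namespace IsMaxDissipative

variable {B : X →L[ℝ] X} {A : X → X → Prop}

theorem sub (hA : IsMaxDissipative B A) {x y x' y' : X} (h : A x y) (h' : A x' y') :
    A (x - x') (y - y') := by
  simpa [sub_eq_add_neg] using hA.add _ _ _ _ h (hA.smul (-1) _ _ h')

theorem resolvent_unique (hB : IsInnerWeight B) (hA : IsMaxDissipative B A) {l : ℝ} (hl : 0 < l)
    {f x x' : X} (h : A x (l • x - f)) (h' : A x' (l • x' - f)) : x = x' := by
  have h1 := hA.dissip _ _ (hA.sub h h')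
  have h2 : l • x - f - (l • x' - f) = l • (x - x') := by rw [smul_sub]; abel
  rw [h2, real_inner_smul_left] at h1
  exact sub_eq_zero.1 (hB.eq_zero_of_energy_nonpos (nonpos_of_mul_nonpos_right h1 hl))

theorem resolvent_energy (hA : IsMaxDissipative B A) {l : ℝ} {f x : X} (h : A x (l • x - f)) :
    l * inner ℝ x (B x) ≤ inner ℝ f (B x) := by
  have h1 := hA.dissip _ _ h
  rw [inner_sub_left, real_inner_smul_left] at h1
  linarith

/-- Uniqueness makes the chosen solutions linear in `f`, and the energy estimate makes them bounded.
The equivalence is the only description of the resolvent used later. -/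
theorem exists_resolvent (hB : IsInnerWeight B) (hA : IsMaxDissipative B A) {l : ℝ} (hl : 0 < l) :
    ∃ R : X →L[ℝ] X, ∀ f x, A x (l • x - f) ↔ x = R f := by
  choose r hr using hA.surj l hl
  have hu : ∀ f x, A x (l • x - f) ↔ x = r f := fun f x =>
    ⟨fun h => hA.resolvent_unique hB hl h (hr f), fun h => h ▸ hr f⟩
  obtain ⟨M, hM, hM'⟩ := hB.exists_norm_le
  let R : X →ₗ[ℝ] X :=
    { toFun := r
      map_add' := fun f g => by
        symm
        rw [← hu]
        convert hA.add _ _ _ _ (hr f) (hr g) using 1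
        rw [smul_add]; abel
      map_smul' := fun a f => by
        symm
        simp only [RingHom.id_apply]
        rw [← hu]
        convert hA.smul a _ _ (hr f) using 1
        rw [smul_sub, smul_comm] }
  refine ⟨R.mkContinuous (l⁻¹ * M) fun f => ?_, hu⟩
  -- With `x = r f`: `l² E(x) ≤ l ⟪f, B x⟫ ≤ (E(f) + l² E(x)) / 2`.
  have h1 : inner ℝ (l • r f) (B (l • r f)) ≤ inner ℝ f (B f) := by
    have h2 := hA.resolvent_energy (hr f)
    have h3 := hB.two_mul_inner_le f (l • r f)
    simp only [map_smul, real_inner_smul_left, real_inner_smul_right] at h3 ⊢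
    nlinarith
  have h2 := hM' _ _ h1
  rw [norm_smul, Real.norm_of_nonneg hl.le] at h2
  change ‖r f‖ ≤ _
  rw [mul_assoc, ← div_eq_inv_mul, le_div_iff₀ hl]
  linarith

/-- Write a vector orthogonal to the domain as `B u` and solve `x - A x = u`. Then `E(x) ≤ ⟪u, B x⟫
= ⟪x, B u⟫ = 0`, so `x = 0`, and single-valuedness at `0` forces `u = 0`. -/
theorem dense_domain [CompleteSpace X] (hB : IsInnerWeight B) (hA : IsMaxDissipative B A) :
    Dense {x | ∃ y, A x y} := by
  let D : Submodule ℝ X :=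
    { carrier := {x | ∃ y, A x y}
      add_mem' := fun ⟨y, hy⟩ ⟨y', hy'⟩ => ⟨_, hA.add _ _ _ _ hy hy'⟩
      zero_mem' := by
        obtain ⟨x, hx⟩ := hA.surj 1 one_pos 0
        exact ⟨_, by simpa using hA.smul 0 _ _ hx⟩
      smul_mem' := fun a x ⟨y, hy⟩ => ⟨_, hA.smul a _ _ hy⟩ }
  change Dense (D : Set X)
  rw [Submodule.dense_iff_topologicalClosure_eq_top, Submodule.topologicalClosure_eq_top_iff,
    Submodule.eq_bot_iff]
  intro y hy
  obtain ⟨u, rfl⟩ := hB.exists_apply_eq y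
  obtain ⟨x, hx⟩ := hA.surj 1 one_pos u
  have h1 := hA.resolvent_energy hx
  have h2 : inner ℝ x (B u) = 0 := (Submodule.mem_orthogonal _ _).1 hy x ⟨_, hx⟩
  have h3 : inner ℝ u (B x) = 0 := by rw [← hB.symm, real_inner_comm]; exact h2
  have hx0 : x = 0 := hB.eq_zero_of_energy_nonpos (by linarith)
  subst hx0
  have h4 : A 0 (-u) := by simpa using hx
  have h5 : u = 0 := by simpa using hA.single _ h4
  rw [h5, map_zero]

end IsMaxDissipative

end Abstract

end TirePDE

namespace TirePDE

/-! ### Exponentials of bounded dissipative operators and Yosida approximations. -/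

section Semigroup

variable {X : Type*} [NormedAddCommGroup X] [InnerProductSpace ℝ X]

/-- `S` (restricted to `t ≥ 0`) is a `C₀`-semigroup on `X`. -/
structure IsContSemigroup (S : ℝ → X →L[ℝ] X) : Prop where
  zero : S 0 = ContinuousLinearMap.id ℝ X
  add : ∀ s t : ℝ, 0 ≤ s → 0 ≤ t → S (s + t) = (S s).comp (S t)
  continuousOn : ∀ x : X, ContinuousOn (fun t => S t x) (Ici 0)

/-- The operator with graph `A` is the infinitesimal generator of `S`. -/
def Generates (A : X → X → Prop) (S : ℝ → X →L[ℝ] X) : Prop :=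
  ∀ x y : X, A x y ↔ Tendsto (fun t : ℝ => t⁻¹ • (S t x - x)) (𝓝[>] 0) (𝓝 y)

/-- A bounded operator which is dissipative for the inner product with weight `B`. -/
def IsDissip (B T : X →L[ℝ] X) : Prop := ∀ u, inner ℝ (T u) (B u) ≤ 0

theorem isDissip_zero (B : X →L[ℝ] X) : IsDissip B 0 := fun u => by simp

section Exp

variable [CompleteSpace X] {B T T' : X →L[ℝ] X}

theorem hasDerivAt_exp_smul_apply (T : X →L[ℝ] X) (x : X) (t : ℝ) :
    HasDerivAt (fun t : ℝ => NormedSpace.exp (t • T) x) (T (NormedSpace.exp (t • T) x)) t := by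
  have h := (hasDerivAt_exp_smul_const' (𝕂 := ℝ) T t).clm_apply (hasDerivAt_const t x)
  simpa using h

theorem IsDissip.energy_exp_le (hB : IsInnerWeight B) (hT : IsDissip B T) {t : ℝ} (ht : 0 ≤ t)
    (x : X) : inner ℝ (NormedSpace.exp (t • T) x) (B (NormedSpace.exp (t • T) x)) ≤
      inner ℝ x (B x) := by
  have h : ∀ t : ℝ, HasDerivAt
      (fun t : ℝ => inner ℝ (NormedSpace.exp (t • T) x) (B (NormedSpace.exp (t • T) x)))
      (2 * inner ℝ (T (NormedSpace.exp (t • T) x)) (B (NormedSpace.exp (t • T) x))) t := fun t => by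
    rw [← hasDerivWithinAt_univ]
    exact hB.hasDerivWithinAt_energy (hasDerivAt_exp_smul_apply T x t).hasDerivWithinAt
  have h1 := antitone_of_deriv_nonpos (fun t => (h t).differentiableAt) (fun t => by
    rw [(h t).deriv]; linarith [hT (NormedSpace.exp (t • T) x)])
  simpa using h1 ht

/-- Interpolate by `s ↦ exp((t-s)T') exp(sT) x`. By commutation its derivative is both exponentials
applied to `T x - T' x`, and each exponential costs one factor `M`. -/
theorem norm_exp_sub_exp_le {M : ℝ} (hM : 1 ≤ M) (hB : IsInnerWeight B)
    (hMB : ∀ x u : X, inner ℝ u (B u) ≤ inner ℝ x (B x) → ‖u‖ ≤ M * ‖x‖)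
    (hT : IsDissip B T) (hT' : IsDissip B T') (hc : Commute T T') {t : ℝ} (ht : 0 ≤ t) (x : X) :
    ‖NormedSpace.exp (t • T) x - NormedSpace.exp (t • T') x‖ ≤ M * (M * ‖T x - T' x‖) * t := by
  have hcomm : ∀ s : ℝ, ∀ y, T' (NormedSpace.exp (s • T) y) = NormedSpace.exp (s • T) (T' y) := by
    intro s y
    have h : Commute T' (NormedSpace.exp (s • T)) := (hc.symm.smul_right s).exp_right
    exact DFunLike.congr_fun h.eq y
  have hcomm' : ∀ s : ℝ, ∀ y, T (NormedSpace.exp (s • T) y) = NormedSpace.exp (s • T) (T y) := by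
    intro s y
    have h : Commute T (NormedSpace.exp (s • T)) := ((Commute.refl T).smul_right s).exp_right
    exact DFunLike.congr_fun h.eq y
  have hd : ∀ s : ℝ, HasDerivAt
      (fun s : ℝ => NormedSpace.exp ((t - s) • T') (NormedSpace.exp (s • T) x))
      (NormedSpace.exp ((t - s) • T') (NormedSpace.exp (s • T) (T x - T' x))) s := by
    intro s
    have h1 := (hasDerivAt_exp_smul_const (𝕂 := ℝ) T' (t - s)).scomp s
      ((hasDerivAt_id s).const_sub t)
    have h2 := h1.clm_apply (hasDerivAt_exp_smul_apply T x s)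
    refine h2.congr_deriv ?_
    rw [map_sub, ← hcomm, ← hcomm']
    simp [sub_eq_neg_add]
  have := norm_image_sub_le_of_norm_deriv_le_segment' (a := 0) (b := t)
    (C := M * (M * ‖T x - T' x‖)) (fun s _ => (hd s).hasDerivWithinAt) (fun s hs => ?_) t
    ⟨ht, le_rfl⟩
  · simpa using this
  · refine (hMB _ _ (hT'.energy_exp_le hB (by linarith [hs.2]) _)).trans ?_
    gcongr
    exact hMB _ _ (hT.energy_exp_le hB hs.1 _)

end Exp

/-- The Yosida approximation of `A`, in terms of the resolvent at `l`. -/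
def yosida (R : X →L[ℝ] X) (l : ℝ) : X →L[ℝ] X := l • (l • R - 1)

theorem yosida_apply (R : X →L[ℝ] X) (l : ℝ) (x : X) : yosida R l x = l • (l • R x - x) := by
  simp [yosida]

namespace IsMaxDissipative

variable {B : X →L[ℝ] X} {A : X → X → Prop}

/-- Here `Y u = A(l R u)` and `u = l R u - l⁻¹ Y u`, so `⟪Y u, B u⟫` is a dissipation term of `A`
minus `l⁻¹ E(Y u)`. -/
theorem isDissip_yosida (hB : IsInnerWeight B) (hA : IsMaxDissipative B A) {l : ℝ} (hl : 0 < l)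
    {R : X →L[ℝ] X} (hR : ∀ f x, A x (l • x - f) ↔ x = R f) : IsDissip B (yosida R l) := by
  intro u
  have h1 := hA.smul l _ _ ((hR u _).2 rfl)
  rw [← yosida_apply] at h1
  have h2 := hA.dissip _ _ h1
  have h3 : u = l • R u - l⁻¹ • yosida R l u := by
    rw [yosida_apply, smul_smul, inv_mul_cancel₀ hl.ne', one_smul]; abel
  have h4 := hB.energy_nonneg (yosida R l u)
  have h5 : inner ℝ (yosida R l u) (B u) = inner ℝ (yosida R l u) (B (l • R u)) -
      l⁻¹ * inner ℝ (yosida R l u) (B (yosida R l u)) := by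
    rw [← real_inner_smul_right, ← inner_sub_right, ← map_smul B l⁻¹, ← map_sub, ← h3]
  have : 0 ≤ l⁻¹ * inner ℝ (yosida R l u) (B (yosida R l u)) := by positivity
  linarith

theorem resolvent_sub {l m : ℝ}
    {R R' : X →L[ℝ] X} (hR : ∀ f x, A x (l • x - f) ↔ x = R f)
    (hR' : ∀ f x, A x (m • x - f) ↔ x = R' f) : R' = R + (l - m) • (R * R') := by
  ext f
  have h1 := (hR' f _).2 rfl
  have h2 : m • R' f - f = l • R' f - (f + (l - m) • R' f) := by rw [sub_smul]; abel
  rw [h2, hR] at h1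
  conv_lhs => rw [h1]
  simp

/-- Compare the resolvent identity with its mirror image and cancel `l - m`; for `l = m` the
identity itself gives equality. -/
theorem commute_resolvent {l m : ℝ}
    {R R' : X →L[ℝ] X} (hR : ∀ f x, A x (l • x - f) ↔ x = R f)
    (hR' : ∀ f x, A x (m • x - f) ↔ x = R' f) : Commute R R' := by
  have h1 := resolvent_sub hR hR'
  have h2 := resolvent_sub hR' hR
  rcases eq_or_ne l m with rfl | hlm
  · have : R' = R := by simpa using h1
    rw [this]
  · have h3 : (l - m) • (R * R') = (l - m) • (R' * R) := by
      rw [← sub_eq_iff_eq_add'.2 h1]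
      have := sub_eq_iff_eq_add'.2 h2
      rw [← neg_sub, this, ← neg_smul, neg_sub]
    exact smul_right_injective _ (sub_ne_zero.2 hlm) h3

theorem commute_yosida {l m : ℝ}
    {R R' : X →L[ℝ] X} (hR : ∀ f x, A x (l • x - f) ↔ x = R f)
    (hR' : ∀ f x, A x (m • x - f) ↔ x = R' f) : Commute (yosida R l) (yosida R' m) := by
  have h := commute_resolvent hR hR'
  unfold yosida
  exact ((((h.smul_left l).smul_right m).sub_right (Commute.one_right _)).sub_left
    (Commute.one_left _)).smul_left l |>.smul_right m

theorem norm_smul_resolvent_le {M : ℝ} (hB : IsInnerWeight B) (hA : IsMaxDissipative B A)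
    (hMB : ∀ x u : X, inner ℝ u (B u) ≤ inner ℝ x (B x) → ‖u‖ ≤ M * ‖x‖) {l : ℝ} (hl : 0 < l)
    {R : X →L[ℝ] X} (hR : ∀ f x, A x (l • x - f) ↔ x = R f) (f : X) :
    ‖l • R f‖ ≤ M * ‖f‖ := by
  refine hMB _ _ ?_
  have h2 := hA.resolvent_energy ((hR f _).2 rfl)
  have h3 := hB.two_mul_inner_le f (l • R f)
  simp only [map_smul, real_inner_smul_left, real_inner_smul_right] at h3 ⊢
  nlinarith

theorem resolvent_apply {l : ℝ}
    {R : X →L[ℝ] X} (hR : ∀ f x, A x (l • x - f) ↔ x = R f) {x y : X} (h : A x y) :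
    x = R (l • x - y) := by
  rw [← hR]; simpa using h

/-- Reduces convergence of `Y x` to `A x` on the domain to the strong convergence of `l R` to the
identity. -/
theorem yosida_apply_of_mem {l : ℝ}
    {R : X →L[ℝ] X} (hR : ∀ f x, A x (l • x - f) ↔ x = R f) {x y : X} (h : A x y) :
    yosida R l x = l • R y := by
  have h1 := resolvent_apply hR h
  rw [map_sub, map_smul] at h1
  rw [yosida_apply]
  nth_rw 2 [h1]
  simp

/-- On the domain `l R x' - x' = R y`, which is `O(1/l)`; the uniform bound on `l R` and density
give the rest. -/
theorem tendsto_smul_resolvent [CompleteSpace X] (hB : IsInnerWeight B)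
    (hA : IsMaxDissipative B A) {l : ℕ → ℝ}
    (hl : ∀ n, 0 < l n) (hl' : Tendsto l atTop atTop) {R : ℕ → X →L[ℝ] X}
    (hR : ∀ n f x, A x (l n • x - f) ↔ x = R n f) (x : X) :
    Tendsto (fun n => l n • R n x) atTop (𝓝 x) := by
  obtain ⟨M, hM, hMB⟩ := hB.exists_norm_le
  rw [Metric.tendsto_atTop]
  intro ε hε
  obtain ⟨x', hx', y, hxy⟩ := Metric.dense_iff.1 (hA.dense_domain hB) x (ε / (3 * M))
    (by positivity)
  have hlim : Tendsto (fun n => (l n)⁻¹ * (M * ‖y‖)) atTop (𝓝 0) := by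
    simpa using hl'.inv_tendsto_atTop.mul_const (M * ‖y‖)
  obtain ⟨N, hN⟩ := Metric.tendsto_atTop.1 hlim (ε / 3) (by positivity)
  refine ⟨N, fun n hn => ?_⟩
  have h1 : ‖l n • R n x' - x'‖ < ε / 3 := by
    have h2 := yosida_apply_of_mem (hR n) hxy
    have h3 : l n • R n x' - x' = (l n)⁻¹ • (l n • R n y) := by
      rw [← h2, yosida_apply, smul_smul, inv_mul_cancel₀ (hl n).ne', one_smul]
    rw [h3, norm_smul, norm_inv, Real.norm_of_nonneg (hl n).le]
    have h4 := hN n hn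
    rw [Real.dist_0_eq_abs] at h4
    refine lt_of_le_of_lt ?_ ((le_abs_self _).trans_lt h4)
    gcongr
    · exact inv_nonneg.2 (hl n).le
    · exact hA.norm_smul_resolvent_le hB hMB (hl n) (hR n) y
  have h2 : ‖l n • R n (x - x')‖ ≤ M * ‖x - x'‖ :=
    hA.norm_smul_resolvent_le hB hMB (hl n) (hR n) _
  have h3 : M * ‖x - x'‖ < ε / 3 := by
    rw [Metric.mem_ball, dist_comm, dist_eq_norm, lt_div_iff₀ (by positivity)] at hx'
    linarith
  have h4 : ‖x' - x‖ < ε / 3 := by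
    rw [norm_sub_rev]
    nlinarith [norm_nonneg (x - x')]
  have h5 : l n • R n x - x = l n • R n (x - x') + (l n • R n x' - x') + (x' - x) := by
    rw [map_sub, smul_sub]; abel
  rw [dist_eq_norm, h5]
  refine (norm_add₃_le).trans_lt ?_
  linarith

end IsMaxDissipative

end Semigroup

end TirePDE

namespace TirePDE

/-! ### The Lumer-Phillips generation theorem. -/

section Generation

variable {X : Type*} [NormedAddCommGroup X] [InnerProductSpace ℝ X]
  {B : X →L[ℝ] X} {A : X → X → Prop}

theorem inner_le_zero_of_tendsto_slope {S : ℝ → X →L[ℝ] X} (hB : IsInnerWeight B)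
    (hS : ∀ t, 0 ≤ t → ∀ x, inner ℝ (S t x) (B (S t x)) ≤ inner ℝ x (B x)) {x y : X}
    (h : Tendsto (fun t : ℝ => t⁻¹ • (S t x - x)) (𝓝[>] 0) (𝓝 y)) : inner ℝ y (B x) ≤ 0 := by
  refine le_of_tendsto (h.inner tendsto_const_nhds) ?_
  filter_upwards [self_mem_nhdsWithin] with t ht
  have ht' : 0 < t := ht
  rw [real_inner_smul_left, inner_sub_left]
  have := hB.two_mul_inner_le (S t x) x
  have := hS t ht'.le x
  exact mul_nonpos_of_nonneg_of_nonpos (inv_nonneg.2 ht'.le) (by linarith)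

variable [CompleteSpace X]

theorem continuous_exp_smul (T : X →L[ℝ] X) : Continuous fun s : ℝ => NormedSpace.exp (s • T) :=
  continuous_iff_continuousAt.2 fun s => (hasDerivAt_exp_smul_const (𝕂 := ℝ) T s).continuousAt

theorem cauchySeq_exp_apply {M : ℝ} (hM : 1 ≤ M) (hB : IsInnerWeight B)
    (hMB : ∀ x u : X, inner ℝ u (B u) ≤ inner ℝ x (B x) → ‖u‖ ≤ M * ‖x‖)
    {T : ℕ → X →L[ℝ] X} (hT : ∀ n, IsDissip B (T n)) (hc : ∀ n m, Commute (T n) (T m))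
    {D : Set X} (hD : Dense D) (hconv : ∀ x ∈ D, CauchySeq fun n => T n x)
    {t : ℝ} (ht : 0 ≤ t) (x : X) : CauchySeq fun n => NormedSpace.exp (t • T n) x := by
  rw [Metric.cauchySeq_iff]
  intro ε hε
  obtain ⟨x', hx', hx'D⟩ := Metric.dense_iff.1 hD x (ε / (3 * M)) (by positivity)
  rw [Metric.mem_ball, dist_comm, dist_eq_norm, lt_div_iff₀ (by positivity)] at hx'
  -- The factor `t + 1` in place of `t` keeps the denominator positive at `t = 0`.
  obtain ⟨N, hN⟩ := Metric.cauchySeq_iff.1 (hconv x' hx'D) (ε / (3 * (M * M * (t + 1))))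
    (by positivity)
  refine ⟨N, fun m hm n hn => ?_⟩
  have h1 : ∀ n, ‖NormedSpace.exp (t • T n) (x - x')‖ ≤ M * ‖x - x'‖ := fun n =>
    hMB _ _ ((hT n).energy_exp_le hB ht _)
  have h2 := norm_exp_sub_exp_le hM hB hMB (hT m) (hT n) (hc m n) ht x'
  have h3 := hN m hm n hn
  rw [dist_eq_norm, lt_div_iff₀ (by positivity)] at h3
  have h4 : M * (M * ‖T m x' - T n x'‖) * t ≤ ‖T m x' - T n x'‖ * (M * M * (t + 1)) := by
    have : 0 ≤ ‖T m x' - T n x'‖ * (M * M) := by positivity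
    nlinarith
  have h5 : NormedSpace.exp (t • T m) x - NormedSpace.exp (t • T n) x =
      NormedSpace.exp (t • T m) (x - x') +
        (NormedSpace.exp (t • T m) x' - NormedSpace.exp (t • T n) x') +
        -NormedSpace.exp (t • T n) (x - x') := by
    simp only [map_sub]; abel
  rw [dist_eq_norm, h5]
  refine norm_add₃_le.trans_lt ?_
  rw [norm_neg]
  linarith [h1 m, h1 n]

theorem exists_semigroup_of_commuting (hB : IsInnerWeight B)
    {T : ℕ → X →L[ℝ] X} (hT : ∀ n, IsDissip B (T n)) (hc : ∀ n m, Commute (T n) (T m))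
    {D : Set X} (hD : Dense D) (hconv : ∀ x ∈ D, CauchySeq fun n => T n x) :
    ∃ S : ℝ → X →L[ℝ] X, IsContSemigroup S ∧ ∀ t, 0 ≤ t → ∀ x,
      Tendsto (fun n => NormedSpace.exp (t • T n) x) atTop (𝓝 (S t x)) := by
  obtain ⟨M, hM, hMB⟩ := hB.exists_norm_le
  have hex : ∀ t : ℝ, ∃ S : X →L[ℝ] X, 0 ≤ t → ∀ x,
      Tendsto (fun n => NormedSpace.exp (t • T n) x) atTop (𝓝 (S x)) := by
    intro t
    by_cases ht : 0 ≤ t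
    -- Banach-Steinhaus makes the pointwise limit a bounded operator. Negative times get the junk
    -- value `0`.
    · choose f hf using fun x =>
        cauchySeq_tendsto_of_complete (cauchySeq_exp_apply hM hB hMB hT hc hD hconv ht x)
      exact ⟨continuousLinearMapOfTendsto (fun n => NormedSpace.exp (t • T n))
        (tendsto_pi_nhds.2 hf), fun _ x => hf x⟩
    · exact ⟨0, fun h => absurd h ht⟩
  choose S hS using hex
  have hbd : ∀ t, 0 ≤ t → ∀ x, ‖S t x‖ ≤ M * ‖x‖ := fun t ht x =>
    le_of_tendsto (hS t ht x).norm
      (Eventually.of_forall fun n => hMB _ _ ((hT n).energy_exp_le hB ht _))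
  have hadd : ∀ s t : ℝ, 0 ≤ s → 0 ≤ t → S (s + t) = (S s).comp (S t) := by
    intro s t hs ht
    ext x
    refine tendsto_nhds_unique (hS (s + t) (add_nonneg hs ht) x) ?_
    let _ : NormedAlgebra ℚ (X →L[ℝ] X) := NormedAlgebra.restrictScalars ℚ ℝ _
    have h1 : ∀ n, NormedSpace.exp ((s + t) • T n) x = NormedSpace.exp (s • T n) (S t x) +
        NormedSpace.exp (s • T n) (NormedSpace.exp (t • T n) x - S t x) := by
      intro n
      rw [← map_add, add_sub_cancel, add_smul, NormedSpace.exp_add_of_commute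
        (((Commute.refl (T n)).smul_left s).smul_right t)]
      rfl
    simp only [h1]
    have h2 : Tendsto (fun n => NormedSpace.exp (s • T n) (NormedSpace.exp (t • T n) x - S t x))
        atTop (𝓝 0) := by
      refine squeeze_zero_norm (a := fun n => M * ‖NormedSpace.exp (t • T n) x - S t x‖)
        (fun n => hMB _ _ ((hT n).energy_exp_le hB hs _)) ?_
      have := (tendsto_iff_norm_sub_tendsto_zero.1 (hS t ht x)).const_mul M
      simpa using this
    simpa using (hS s hs (S t x)).add h2
  have hS0 : S 0 = ContinuousLinearMap.id ℝ X := by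
    ext x
    refine tendsto_nhds_unique (hS 0 le_rfl x) ?_
    simp
  refine ⟨S, ⟨hS0, hadd, ?_⟩, hS⟩
  -- Strong continuity: orbits starting in `D` are Lipschitz, and any orbit is a uniform limit of
  -- these.
  have hcD : ∀ x ∈ D, ContinuousOn (fun t => S t x) (Ici 0) := by
    intro x hx
    obtain ⟨C, hC⟩ := (hconv x hx).isBounded_range.exists_norm_le
    have hC' : ∀ n, ‖T n x‖ ≤ C := fun n => hC _ (mem_range_self n)
    have hC0 : 0 ≤ C := (norm_nonneg _).trans (hC' 0)
    have h1 : ∀ t, 0 ≤ t → ‖S t x - x‖ ≤ M * (M * C) * t := by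
      intro t ht
      refine le_of_tendsto ((hS t ht x).sub_const x).norm (Eventually.of_forall fun n => ?_)
      -- Comparison with the zero operator, whose exponential is the identity.
      have := norm_exp_sub_exp_le hM hB hMB (hT n) (isDissip_zero B) (Commute.zero_right _) ht x
      simp only [smul_zero, NormedSpace.exp_zero, one_apply_eq_self,
        zero_apply, sub_zero] at this
      refine this.trans ?_
      gcongr
      exact hC' n
    have h2 : ∀ s t, 0 ≤ s → s ≤ t → ‖S t x - S s x‖ ≤ M * (M * (M * C)) * (t - s) := by
      intro s t hs hst
      have h3 : S t x - S s x = S s (S (t - s) x - x) := by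
        rw [map_sub, ← ContinuousLinearMap.comp_apply, ← hadd s _ hs (sub_nonneg.2 hst),
          add_sub_cancel]
      rw [h3]
      refine (hbd s hs _).trans ?_
      rw [mul_assoc]
      gcongr
      exact h1 _ (sub_nonneg.2 hst)
    refine (LipschitzOnWith.of_dist_le_mul (K := (M * (M * (M * C))).toNNReal)
      fun t ht s hs => ?_).continuousOn
    rw [Real.coe_toNNReal _ (by positivity), dist_eq_norm, Real.dist_eq]
    rcases le_total s t with h | h
    · rw [abs_of_nonneg (sub_nonneg.2 h)]
      exact h2 s t hs h
    · rw [norm_sub_rev, abs_sub_comm, abs_of_nonneg (sub_nonneg.2 h)]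
      exact h2 t s ht h
  intro x
  refine continuousOn_of_uniform_approx_of_continuousOn fun u hu => ?_
  obtain ⟨ε, hε, hεu⟩ := Metric.mem_uniformity_dist.1 hu
  obtain ⟨x', hx', hx'D⟩ := Metric.dense_iff.1 hD x (ε / M) (by positivity)
  rw [Metric.mem_ball, dist_comm, dist_eq_norm, lt_div_iff₀ (by positivity)] at hx'
  refine ⟨_, hcD x' hx'D, fun t ht => hεu ?_⟩
  rw [dist_eq_norm, ← map_sub]
  exact (hbd t ht _).trans_lt (by linarith)

theorem IsContSemigroup.energy_le_of_exp_tendsto {S : ℝ → X →L[ℝ] X} (hB : IsInnerWeight B)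
    {T : ℕ → X →L[ℝ] X} (hT : ∀ n, IsDissip B (T n)) {t : ℝ} (ht : 0 ≤ t) {x : X}
    (h : Tendsto (fun n => NormedSpace.exp (t • T n) x) atTop (𝓝 (S t x))) :
    inner ℝ (S t x) (B (S t x)) ≤ inner ℝ x (B x) :=
  le_of_tendsto (h.inner (B.continuous.tendsto _ |>.comp h))
    (Eventually.of_forall fun n => (hT n).energy_exp_le hB ht x)

theorem tendsto_slope_of_eq_integral {S : ℝ → X →L[ℝ] X} (hS : IsContSemigroup S) {x y : X}
    (h : ∀ t, 0 ≤ t → S t x - x = ∫ s in (0 : ℝ)..t, S s y) :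
    Tendsto (fun t : ℝ => t⁻¹ • (S t x - x)) (𝓝[>] 0) (𝓝 y) := by
  have hd : HasDerivWithinAt (fun t => ∫ s in (0 : ℝ)..t, S s y) (S 0 y) (Ici 0) 0 :=
    intervalIntegral.integral_hasDerivWithinAt_right (by simp)
      (((hS.continuousOn y).mono Ioi_subset_Ici_self).stronglyMeasurableAtFilter_nhdsWithin
        measurableSet_Ioi 0)
      (((hS.continuousOn y) 0 (by simp)).mono Ioi_subset_Ici_self)
  have h1 := (hasDerivWithinAt_iff_tendsto_slope' (by simp)).1 (hd.mono Ioi_subset_Ici_self)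
  rw [hS.zero] at h1
  refine h1.congr' ?_
  filter_upwards [self_mem_nhdsWithin] with t ht
  rw [h t (le_of_lt ht), slope_def_module]
  simp

/-- The Lumer-Phillips theorem in a Hilbert space, for a weighted inner product. -/
theorem IsMaxDissipative.exists_semigroup (hB : IsInnerWeight B) (hA : IsMaxDissipative B A) :
    ∃ S : ℝ → X →L[ℝ] X, IsContSemigroup S ∧ Generates A S := by
  obtain ⟨M, hM, hMB⟩ := hB.exists_norm_le
  have hl : ∀ n : ℕ, (0 : ℝ) < n + 1 := fun n => by positivity
  have hl' : Tendsto (fun n : ℕ => (n : ℝ) + 1) atTop atTop :=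
    tendsto_atTop_add_const_right _ _ tendsto_natCast_atTop_atTop
  choose R hR using fun n => hA.exists_resolvent hB (hl n)
  have hY : ∀ x y, A x y → Tendsto (fun n => yosida (R n) (n + 1) x) atTop (𝓝 y) := by
    intro x y h
    simp only [fun n => yosida_apply_of_mem (hR n) h]
    exact hA.tendsto_smul_resolvent hB hl hl' hR y
  have hT : ∀ n, IsDissip B (yosida (R n) (n + 1)) := fun n => hA.isDissip_yosida hB (hl n) (hR n)
  obtain ⟨S, hS, hlim⟩ := exists_semigroup_of_commuting hB hT
    (fun n m => commute_yosida (hR n) (hR m)) (hA.dense_domain hB)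
    (fun x ⟨y, h⟩ => (hY x y h).cauchySeq)
  -- Passes to the limit in `exp(tYₙ)x - x = ∫ exp(sYₙ) Yₙ x ds` by dominated convergence.
  have hfwd : ∀ x y, A x y → Tendsto (fun t : ℝ => t⁻¹ • (S t x - x)) (𝓝[>] 0) (𝓝 y) := by
    intro x y h
    refine tendsto_slope_of_eq_integral hS fun t ht => ?_
    have h1 : ∀ n, NormedSpace.exp (t • yosida (R n) (n + 1)) x - x =
        ∫ s in (0 : ℝ)..t, NormedSpace.exp (s • yosida (R n) (n + 1))
          (yosida (R n) (n + 1) x) := by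
      intro n
      have h2 := intervalIntegral.integral_eq_sub_of_hasDerivAt (a := 0) (b := t)
        (fun s _ => (hasDerivAt_exp_smul_const (𝕂 := ℝ) (yosida (R n) (n + 1)) s).clm_apply
          (hasDerivAt_const s x)) ?_
      · simpa using h2.symm
      · refine Continuous.intervalIntegrable ?_ _ _
        exact ((continuous_exp_smul _).mul continuous_const).clm_apply continuous_const |>.add
          ((continuous_exp_smul _).clm_apply continuous_const)
    refine tendsto_nhds_unique ((hlim t ht x).sub_const x) ?_
    simp only [h1]
    obtain ⟨C, hC⟩ := (hY x y h).cauchySeq.isBounded_range.exists_norm_le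
    refine intervalIntegral.tendsto_integral_filter_of_dominated_convergence (fun _ => M * C)
      (Eventually.of_forall fun n => ?_) (Eventually.of_forall fun n => ?_) (by simp) ?_
    · exact ((continuous_exp_smul _).clm_apply continuous_const).aestronglyMeasurable
    · refine Eventually.of_forall fun s hs => ?_
      rw [uIoc_of_le ht] at hs
      refine (hMB _ _ ((hT n).energy_exp_le hB hs.1.le _)).trans ?_
      gcongr
      exact hC _ (mem_range_self n)
    · refine Eventually.of_forall fun s hs => ?_
      rw [uIoc_of_le ht] at hs
      have h2 : Tendsto (fun n => NormedSpace.exp (s • yosida (R n) (n + 1))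
          (yosida (R n) (n + 1) x - y)) atTop (𝓝 0) := by
        refine squeeze_zero_norm (a := fun n => M * ‖yosida (R n) (n + 1) x - y‖)
          (fun n => hMB _ _ ((hT n).energy_exp_le hB hs.1.le _)) ?_
        have := (tendsto_iff_norm_sub_tendsto_zero.1 (hY x y h)).const_mul M
        simpa using this
      simpa using (hlim s hs.1.le y).add h2
  refine ⟨S, hS, fun x y => ⟨hfwd x y, fun h => ?_⟩⟩
  -- The generator of `S` is no larger than `A`: with `x' - A x' = x - y`, the slopes at `d = x -
  -- x'` tend to `d` itself. Since `S` contracts the energy, `E(d) ≤ 0`.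
  obtain ⟨x', hx'⟩ := hA.surj 1 one_pos (x - y)
  have h1 := h.sub (hfwd _ _ hx')
  have h2 := inner_le_zero_of_tendsto_slope (S := S) (x := x - x')
    (y := y - ((1 : ℝ) • x' - (x - y))) hB
    (fun t ht x => IsContSemigroup.energy_le_of_exp_tendsto hB hT ht (hlim t ht x))
    (h1.congr fun t => by rw [← smul_sub, map_sub]; congr 1; abel)
  have h3 : y - ((1 : ℝ) • x' - (x - y)) = x - x' := by rw [one_smul]; abel
  rw [h3] at h2
  have h4 := sub_eq_zero.1 (hB.eq_zero_of_energy_nonpos h2)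
  subst h4
  simpa using hx'

end Generation

end TirePDE

namespace TirePDE

/-! ### Energy inequalities for the semigroup and for the variation of constants formula. -/

section Energy

variable {X : Type*} [NormedAddCommGroup X] [InnerProductSpace ℝ X]
  {B : X →L[ℝ] X} {A : X → X → Prop} {S : ℝ → X →L[ℝ] X}

theorem tendsto_sub_nhdsGT (t : ℝ) : Tendsto (fun s => s - t) (𝓝[>] t) (𝓝[>] 0) := by
  refine tendsto_nhdsWithin_of_tendsto_nhds_of_eventually_within _ ?_ ?_
  · have : Tendsto (fun s => s - t) (𝓝 t) (𝓝 (t - t)) := (continuous_sub_right t).tendsto t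
    rw [sub_self] at this
    exact this.mono_left nhdsWithin_le_nhds
  · filter_upwards [self_mem_nhdsWithin] with s hs
    exact sub_pos.2 (mem_Ioi.1 hs)

/-- The generator limit gives the right derivative directly, and the comparison principle below
needs no more. -/
theorem IsContSemigroup.hasDerivWithinAt (hS : IsContSemigroup S) (hG : Generates A S) {x y : X}
    (h : A x y) {t : ℝ} (ht : 0 ≤ t) :
    HasDerivWithinAt (fun s => S s x) (S t y) (Ici t) t := by
  rw [← hasDerivWithinAt_Ioi_iff_Ici, hasDerivWithinAt_iff_tendsto_slope' (by simp)]
  have h1 := tendsto_sub_nhdsGT t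
  refine (((S t).continuous.tendsto y).comp (((hG x y).1 h).comp h1)).congr' ?_
  filter_upwards [self_mem_nhdsWithin] with s hs
  have h2 : S s = (S t).comp (S (s - t)) := by
    rw [← hS.add t _ ht (sub_nonneg.2 (le_of_lt hs)), add_sub_cancel]
  simp [slope_def_module, h2]

theorem IsContSemigroup.domain_invariant (hS : IsContSemigroup S) (hG : Generates A S) {x y : X}
    (h : A x y) {t : ℝ} (ht : 0 ≤ t) : A (S t x) (S t y) := by
  rw [hG]
  refine (((S t).continuous.tendsto y).comp ((hG x y).1 h)).congr' ?_
  filter_upwards [self_mem_nhdsWithin] with s hs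
  have h2 : (S t) (S s x) = S s (S t x) := by
    rw [← ContinuousLinearMap.comp_apply, ← ContinuousLinearMap.comp_apply,
      ← hS.add t s ht (le_of_lt hs), ← hS.add s t (le_of_lt hs) ht, add_comm]
  simp [h2]

/-- Joint continuity of a uniformly bounded semigroup. -/
theorem IsContSemigroup.continuous_apply (hS : IsContSemigroup S) {M : ℝ}
    (hM : ∀ t, 0 ≤ t → ∀ x, ‖S t x‖ ≤ M * ‖x‖) :
    Continuous fun p : ℝ × X => S (max p.1 0) p.2 := by
  rw [continuous_iff_continuousAt]
  rintro ⟨t, x⟩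
  have h1 : Continuous fun p : ℝ × X => S (max p.1 0) x :=
    (hS.continuousOn x).comp_continuous (by fun_prop) (fun p => mem_Ici.2 (le_max_right _ _))
  have h2 : Tendsto (fun p : ℝ × X => S (max p.1 0) (p.2 - x)) (𝓝 (t, x)) (𝓝 0) := by
    refine squeeze_zero_norm (a := fun p : ℝ × X => M * ‖p.2 - x‖)
      (fun p => hM _ (le_max_right _ _) _) ?_
    have : Continuous fun p : ℝ × X => M * ‖p.2 - x‖ := by fun_prop
    simpa using this.tendsto (t, x)
  have h3 := (h1.tendsto (t, x)).add h2
  simpa [ContinuousAt] using h3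

theorem hasDerivWithinAt_integral_Ici {E : Type*} [NormedAddCommGroup E] [NormedSpace ℝ E]
    [CompleteSpace E] {φ : ℝ → E} {a t : ℝ} (hφ : ContinuousOn φ (Ici a)) (ht : a ≤ t) :
    HasDerivWithinAt (fun t => ∫ s in a..t, φ s) (φ t) (Ici t) t := by
  refine intervalIntegral.integral_hasDerivWithinAt_right
    ((hφ.mono ?_).intervalIntegrable) ?_ ?_
  · rw [uIcc_of_le ht]; exact Icc_subset_Ici_self
  · exact ((hφ.mono (Ioi_subset_Ici ht)).stronglyMeasurableAtFilter_nhdsWithin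
      measurableSet_Ioi t)
  · exact (hφ t ht).mono (Ioi_subset_Ici ht)

theorem continuousOn_integral_Ici {E : Type*} [NormedAddCommGroup E] [NormedSpace ℝ E]
    {φ : ℝ → E} {a b : ℝ} (hφ : ContinuousOn φ (Ici a)) (hab : a ≤ b) :
    ContinuousOn (fun t => ∫ s in a..t, φ s) (Icc a b) := by
  rw [← uIcc_of_le hab]
  refine intervalIntegral.continuousOn_primitive_interval
    (ContinuousOn.integrableOn_compact isCompact_uIcc (hφ.mono ?_))
  rw [uIcc_of_le hab]; exact Icc_subset_Ici_self

theorem IsContSemigroup.energy_le_of_mem (hB : IsInnerWeight B) (hS : IsContSemigroup S)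
    (hG : Generates A S) {ω : ℝ} (hA : ∀ x y, A x y → inner ℝ y (B x) ≤ -ω * ‖x‖ ^ 2)
    {x y : X} (h : A x y) {t : ℝ} (ht : 0 ≤ t) :
    inner ℝ (S t x) (B (S t x)) ≤
      inner ℝ x (B x) + ∫ s in (0 : ℝ)..t, -(2 * ω) * ‖S s x‖ ^ 2 := by
  have hc := hS.continuousOn x
  have hc' : ContinuousOn (fun s => -(2 * ω) * ‖S s x‖ ^ 2) (Ici 0) := by fun_prop
  refine image_le_of_liminf_slope_right_le_deriv_boundary (a := 0) (b := t)
    (f := fun t => inner ℝ (S t x) (B (S t x)))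
    (B := fun t => inner ℝ x (B x) + ∫ s in (0 : ℝ)..t, -(2 * ω) * ‖S s x‖ ^ 2)
    (B' := fun t => -(2 * ω) * ‖S t x‖ ^ 2) ?_ ?_ ?_ ?_ ?_ ⟨ht, le_rfl⟩
  · exact (hc.inner (B.continuous.comp_continuousOn hc)).mono Icc_subset_Ici_self
  · simp [hS.zero]
  · exact continuousOn_const.add (continuousOn_integral_Ici hc' ht)
  · exact fun s hs => (hasDerivWithinAt_integral_Ici hc' hs.1).const_add _
  · intro s hs r hr
    have h1 := hB.hasDerivWithinAt_energy (hS.hasDerivWithinAt hG h hs.1)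
    have h2 := hA _ _ (hS.domain_invariant hG h hs.1)
    exact h1.liminf_right_slope_le (by linarith)

/-- Stated for any semigroup generated by `A`, not only the one constructed above. It supplies the
uniform bound, hence the joint continuity, needed to extend the sharper inequality off the domain.
-/
theorem IsContSemigroup.energy_nonincreasing (hB : IsInnerWeight B) (hS : IsContSemigroup S)
    (hG : Generates A S) (hD : Dense {x | ∃ y, A x y}) {ω : ℝ} (hω : 0 ≤ ω)
    (hA : ∀ x y, A x y → inner ℝ y (B x) ≤ -ω * ‖x‖ ^ 2) {t : ℝ} (ht : 0 ≤ t) (x : X) :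
    inner ℝ (S t x) (B (S t x)) ≤ inner ℝ x (B x) := by
  have hcl : IsClosed {x | inner ℝ (S t x) (B (S t x)) ≤ inner ℝ x (B x)} :=
    isClosed_le (by fun_prop) (by fun_prop)
  refine hcl.closure_subset_iff.2 ?_ (hD x)
  rintro x ⟨y, h⟩
  have h1 := hS.energy_le_of_mem hB hG hA h ht
  have h2 : ∫ s in (0 : ℝ)..t, -(2 * ω) * ‖S s x‖ ^ 2 ≤ 0 := by
    rw [intervalIntegral.integral_const_mul]
    refine mul_nonpos_of_nonpos_of_nonneg (by linarith)
      (intervalIntegral.integral_nonneg ht fun s _ => by positivity)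
  exact h1.trans (by linarith)

/-- Both sides are continuous in `x`, so density suffices. The truncation `max s 0` changes nothing
on `[0,t]` and makes the integrand continuous on the whole line. -/
theorem IsContSemigroup.energy_le (hB : IsInnerWeight B) (hS : IsContSemigroup S)
    (hG : Generates A S) (hD : Dense {x | ∃ y, A x y}) {ω : ℝ} (hω : 0 ≤ ω)
    (hA : ∀ x y, A x y → inner ℝ y (B x) ≤ -ω * ‖x‖ ^ 2) {t : ℝ} (ht : 0 ≤ t) (x : X) :
    inner ℝ (S t x) (B (S t x)) ≤
      inner ℝ x (B x) + ∫ s in (0 : ℝ)..t, -(2 * ω) * ‖S (max s 0) x‖ ^ 2 := by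
  obtain ⟨M, -, hMB⟩ := hB.exists_norm_le
  have hj := hS.continuous_apply
    (fun t ht x => hMB _ _ (hS.energy_nonincreasing hB hG hD hω hA ht x))
  have hint : Continuous fun x : X => ∫ s in (0 : ℝ)..t, -(2 * ω) * ‖S (max s 0) x‖ ^ 2 := by
    refine intervalIntegral.continuous_parametric_intervalIntegral_of_continuous ?_
      continuous_const
    have : Continuous fun p : X × ℝ => S (max p.2 0) p.1 := hj.comp continuous_swap
    exact continuous_const.mul (this.norm.pow 2)
  have hcl : IsClosed {x | inner ℝ (S t x) (B (S t x)) ≤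
      inner ℝ x (B x) + ∫ s in (0 : ℝ)..t, -(2 * ω) * ‖S (max s 0) x‖ ^ 2} :=
    isClosed_le (by fun_prop) (by fun_prop)
  refine hcl.closure_subset_iff.2 ?_ (hD x)
  rintro x ⟨y, h⟩
  have h1 := hS.energy_le_of_mem hB hG hA h ht
  rwa [intervalIntegral.integral_congr (g := fun s => -(2 * ω) * ‖S (max s 0) x‖ ^ 2)] at h1
  intro s hs
  rw [uIcc_of_le ht] at hs
  simp [max_eq_left hs.1]

/-- The variation of constants formula, with the semigroup extended constantly to negative
times. -/
noncomputable def duhamel (S : ℝ → X →L[ℝ] X) (z₀ : X) (f : ℝ → X) (t : ℝ) : X :=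
  S (max t 0) z₀ + ∫ s in (0 : ℝ)..t, S (max (t - s) 0) (f s)

theorem continuous_duhamel
    (hj : Continuous fun p : ℝ × X => S (max p.1 0) p.2) (z₀ : X) {f : ℝ → X}
    (hf : Continuous f) : Continuous (duhamel S z₀ f) := by
  refine Continuous.add (hj.comp (by fun_prop : Continuous fun t : ℝ => (t, z₀))) ?_
  refine intervalIntegral.continuous_parametric_intervalIntegral_of_continuous ?_ continuous_id
  exact hj.comp (by fun_prop : Continuous fun p : ℝ × ℝ => (p.1 - p.2, f p.2))

variable [CompleteSpace X]

/-- Restarting at time `t` exhibits the solution as a free orbit plus a forcing increment. -/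
theorem duhamel_add (hS : IsContSemigroup S)
    (hj : Continuous fun p : ℝ × X => S (max p.1 0) p.2) (z₀ : X) {f : ℝ → X}
    (hf : Continuous f) {t h : ℝ} (ht : 0 ≤ t) (hh : 0 ≤ h) :
    duhamel S z₀ f (t + h) =
      S h (duhamel S z₀ f t) + ∫ s in t..(t + h), S (max (t + h - s) 0) (f s) := by
  have hc : ∀ r, Continuous fun s => S (max (r - s) 0) (f s) := fun r =>
    hj.comp (by fun_prop : Continuous fun s : ℝ => (r - s, f s))
  have hsum := intervalIntegral.integral_add_adjacent_intervals
    ((hc (t + h)).intervalIntegrable (μ := volume) 0 t)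
    ((hc (t + h)).intervalIntegrable (μ := volume) t (t + h))
  unfold duhamel
  rw [← hsum, map_add, ← ContinuousLinearMap.intervalIntegral_comp_comm _
    ((hc t).intervalIntegrable _ _), ← add_assoc]
  rw [max_eq_left ht, max_eq_left (add_nonneg ht hh), ← ContinuousLinearMap.comp_apply,
    ← hS.add h t hh ht, add_comm h t]
  congr 2
  refine intervalIntegral.integral_congr fun s hs => ?_
  rw [uIcc_of_le ht] at hs
  rw [← ContinuousLinearMap.comp_apply, ← hS.add h _ hh (le_max_right _ _),
    max_eq_left (by linarith [hs.2]), max_eq_left (by linarith [hs.2])]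
  congr 2
  ring

theorem tendsto_duhamel_increment (hS : IsContSemigroup S)
    (hj : Continuous fun p : ℝ × X => S (max p.1 0) p.2) {f : ℝ → X} (hf : Continuous f) (t : ℝ) :
    Tendsto (fun h : ℝ => h⁻¹ • ∫ s in t..(t + h), S (max (t + h - s) 0) (f s)) (𝓝[>] 0)
      (𝓝 (f t)) := by
  rw [Metric.tendsto_nhdsWithin_nhds]
  intro ε hε
  have hcont : Continuous fun p : ℝ × ℝ => S (max p.1 0) (f p.2) :=
    hj.comp (by fun_prop : Continuous fun p : ℝ × ℝ => (p.1, f p.2))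
  obtain ⟨δ, hδ, hδ'⟩ := Metric.continuous_iff.1 hcont (0, t) (ε / 2) (by positivity)
  simp only [max_self, hS.zero, ContinuousLinearMap.id_apply] at hδ'
  refine ⟨δ, hδ, fun {h} hh hhδ => ?_⟩
  have hh0 : 0 < h := hh
  rw [Real.dist_0_eq_abs, abs_of_pos hh0] at hhδ
  have hc : Continuous fun s => S (max (t + h - s) 0) (f s) :=
    hj.comp (by fun_prop : Continuous fun s : ℝ => (t + h - s, f s))
  have h1 : h⁻¹ • (∫ s in t..(t + h), S (max (t + h - s) 0) (f s)) - f t =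
      h⁻¹ • ∫ s in t..(t + h), (S (max (t + h - s) 0) (f s) - f t) := by
    rw [intervalIntegral.integral_sub (hc.intervalIntegrable _ _) (by simp),
      intervalIntegral.integral_const, smul_sub, add_sub_cancel_left, smul_smul,
      inv_mul_cancel₀ hh0.ne', one_smul]
  rw [dist_eq_norm, h1, norm_smul, norm_inv, Real.norm_of_nonneg hh0.le]
  have h2 : ‖∫ s in t..(t + h), (S (max (t + h - s) 0) (f s) - f t)‖ ≤
      ε / 2 * |t + h - t| := by
    refine intervalIntegral.norm_integral_le_of_norm_le_const fun s hs => ?_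
    rw [uIoc_of_le (by linarith)] at hs
    rw [← dist_eq_norm]
    refine (hδ' (t + h - s, s) ?_).le
    rw [Prod.dist_eq, max_lt_iff, Real.dist_eq, Real.dist_eq, abs_lt, abs_lt]
    refine ⟨⟨?_, ?_⟩, ?_, ?_⟩ <;> simp only <;> linarith [hs.1, hs.2]
  rw [add_sub_cancel_left, abs_of_pos hh0] at h2
  calc _ ≤ h⁻¹ * (ε / 2 * h) := by gcongr
    _ = ε / 2 := by field_simp
    _ < ε := by linarith

/-- The energy inequality for mild solutions of the inhomogeneous equation. -/
theorem IsContSemigroup.energy_duhamel_le (hB : IsInnerWeight B) (hS : IsContSemigroup S)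
    (hG : Generates A S) (hD : Dense {x | ∃ y, A x y}) {ω : ℝ} (hω : 0 ≤ ω)
    (hA : ∀ x y, A x y → inner ℝ y (B x) ≤ -ω * ‖x‖ ^ 2) (z₀ : X) {f : ℝ → X}
    (hf : Continuous f) {t : ℝ} (ht : 0 ≤ t) :
    inner ℝ (duhamel S z₀ f t) (B (duhamel S z₀ f t)) ≤ inner ℝ z₀ (B z₀) +
      ∫ s in (0 : ℝ)..t, (-(2 * ω) * ‖duhamel S z₀ f s‖ ^ 2 +
        2 * inner ℝ (f s) (B (duhamel S z₀ f s))) := by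
  obtain ⟨M, -, hMB⟩ := hB.exists_norm_le
  have hj := hS.continuous_apply
    (fun t ht x => hMB _ _ (hS.energy_nonincreasing hB hG hD hω hA ht x))
  set z := duhamel S z₀ f with hz
  have hzc : Continuous z := continuous_duhamel hj z₀ hf
  have hφ : Continuous fun s => -(2 * ω) * ‖z s‖ ^ 2 + 2 * inner ℝ (f s) (B (z s)) := by fun_prop
  refine image_le_of_liminf_slope_right_le_deriv_boundary (a := 0) (b := t)
    (f := fun t => inner ℝ (z t) (B (z t)))
    (B := fun t => inner ℝ z₀ (B z₀) + ∫ s in (0 : ℝ)..t, (-(2 * ω) * ‖z s‖ ^ 2 +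
        2 * inner ℝ (f s) (B (z s))))
    (B' := fun s => -(2 * ω) * ‖z s‖ ^ 2 + 2 * inner ℝ (f s) (B (z s))) ?_ ?_ ?_ ?_ ?_ ⟨ht, le_rfl⟩
  · exact (by fun_prop : Continuous _).continuousOn
  · simp [hz, duhamel, hS.zero]
  · exact continuousOn_const.add (continuousOn_integral_Ici hφ.continuousOn ht)
  · exact fun s hs => (hasDerivWithinAt_integral_Ici hφ.continuousOn hs.1).const_add _
  -- `z s` need not lie in the domain, so only an upper bound for the right slope of the energy is
  -- sought.
  · intro s hs r hr
    refine Eventually.frequently ?_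
    set q : ℝ → X := fun h => ∫ τ in s..(s + h), S (max (s + h - τ) 0) (f τ) with hq
    have hq1 : Tendsto (fun h => h⁻¹ • q h) (𝓝[>] 0) (𝓝 (f s)) :=
      tendsto_duhamel_increment hS hj hf s
    have hid : Tendsto (fun h : ℝ => h) (𝓝[>] 0) (𝓝 0) := tendsto_id.mono_left nhdsWithin_le_nhds
    have hq0 : Tendsto q (𝓝[>] 0) (𝓝 0) := by
      have := hid.smul hq1
      rw [zero_smul] at this
      refine this.congr' ?_
      filter_upwards [self_mem_nhdsWithin] with h hh
      rw [smul_smul, mul_inv_cancel₀ (ne_of_gt hh), one_smul]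
    have hSz : Tendsto (fun h => S (max h 0) (z s)) (𝓝[>] 0) (𝓝 (z s)) := by
      have : Continuous fun h => S (max h 0) (z s) :=
        hj.comp (by fun_prop : Continuous fun h : ℝ => (h, z s))
      have := this.tendsto 0
      simp only [max_self, hS.zero, ContinuousLinearMap.id_apply] at this
      exact this.mono_left nhdsWithin_le_nhds
    have hi : Tendsto (fun h => h⁻¹ * ∫ τ in (0 : ℝ)..h, -(2 * ω) * ‖S (max τ 0) (z s)‖ ^ 2)
        (𝓝[>] 0) (𝓝 (-(2 * ω) * ‖z s‖ ^ 2)) := by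
      have hc : Continuous fun τ => -(2 * ω) * ‖S (max τ 0) (z s)‖ ^ 2 :=
        continuous_const.mul ((hj.comp
          (by fun_prop : Continuous fun h : ℝ => (h, z s))).norm.pow 2)
      have h1 := hasDerivWithinAt_integral_Ici (a := 0) hc.continuousOn le_rfl
      have h2 := (hasDerivWithinAt_iff_tendsto_slope' (by simp)).1 (h1.mono Ioi_subset_Ici_self)
      simp only [max_self, hS.zero, ContinuousLinearMap.id_apply] at h2
      refine h2.congr fun h => ?_
      rw [slope_def_module]
      simp
    -- The expansion of `E(S(h)z + q)` divided by `h`, with the free part replaced by its integral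
    -- bound. The term quadratic in `q` vanishes since `q/h` converges and `q → 0`.
    have hlim : Tendsto (fun h => h⁻¹ * (∫ τ in (0 : ℝ)..h, -(2 * ω) * ‖S (max τ 0) (z s)‖ ^ 2) +
        2 * inner ℝ (h⁻¹ • q h) (B (S (max h 0) (z s))) + inner ℝ (h⁻¹ • q h) (B (q h))) (𝓝[>] 0)
        (𝓝 (-(2 * ω) * ‖z s‖ ^ 2 + 2 * inner ℝ (f s) (B (z s)) + inner ℝ (f s) (B 0))) :=
      (hi.add ((hq1.inner ((B.continuous.tendsto _).comp hSz)).const_mul 2)).add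
        (hq1.inner ((B.continuous.tendsto _).comp hq0))
    rw [map_zero, inner_zero_right, add_zero] at hlim
    have hev := (tendsto_sub_nhdsGT s).eventually ((hlim.eventually (gt_mem_nhds hr)).and self_mem_nhdsWithin)
    filter_upwards [hev] with τ hτ
    obtain ⟨hτ1, hτ2⟩ := hτ
    have hh : 0 < τ - s := hτ2
    refine lt_of_le_of_lt ?_ hτ1
    have h1 : z (s + (τ - s)) = S (τ - s) (z s) + q (τ - s) :=
      duhamel_add hS hj z₀ hf hs.1 hh.le
    rw [add_sub_cancel] at h1
    have h2 := hS.energy_le hB hG hD hω hA hh.le (z s)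
    rw [slope_def_module, smul_eq_mul, h1, hB.energy_add, max_eq_left hh.le, real_inner_smul_left,
      real_inner_smul_left]
    have h3 : (τ - s)⁻¹ * (inner ℝ (S (τ - s) (z s)) (B (S (τ - s) (z s))) +
        2 * inner ℝ (q (τ - s)) (B (S (τ - s) (z s))) + inner ℝ (q (τ - s)) (B (q (τ - s))) -
          inner ℝ (z s) (B (z s))) ≤ (τ - s)⁻¹ *
        ((∫ τ in (0 : ℝ)..(τ - s), -(2 * ω) * ‖S (max τ 0) (z s)‖ ^ 2) +
        2 * inner ℝ (q (τ - s)) (B (S (τ - s) (z s))) + inner ℝ (q (τ - s)) (B (q (τ - s)))) := by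
      gcongr
      linarith
    refine h3.trans (le_of_eq ?_)
    ring

end Energy

end TirePDE

namespace TirePDE

/-! ### Mild solutions for Lipschitz nonlinearities. -/

section Existence

variable {X : Type*} [NormedAddCommGroup X] [InnerProductSpace ℝ X]
  {S : ℝ → X →L[ℝ] X}

theorem norm_duhamel_sub_le {M : ℝ} (hM0 : 0 ≤ M)
    (hj : Continuous fun p : ℝ × X => S (max p.1 0) p.2)
    (hM : ∀ t, 0 ≤ t → ∀ x, ‖S t x‖ ≤ M * ‖x‖) (z₀ : X) {f g : ℝ → X} (hf : Continuous f)
    (hg : Continuous g) {b : ℝ → ℝ} (hb : Continuous b) {t : ℝ} (ht : 0 ≤ t)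
    (h : ∀ s ∈ Icc 0 t, ‖f s - g s‖ ≤ b s) :
    ‖duhamel S z₀ f t - duhamel S z₀ g t‖ ≤ M * ∫ s in (0 : ℝ)..t, b s := by
  have hc : ∀ f : ℝ → X, Continuous f → Continuous fun s => S (max (t - s) 0) (f s) := fun f hf =>
    hj.comp (by fun_prop : Continuous fun s : ℝ => (t - s, f s))
  unfold duhamel
  rw [add_sub_add_left_eq_sub, ← intervalIntegral.integral_sub
    ((hc f hf).intervalIntegrable _ _) ((hc g hg).intervalIntegrable _ _),
    ← intervalIntegral.integral_const_mul]
  refine intervalIntegral.norm_integral_le_of_norm_le ht (Eventually.of_forall fun s hs => ?_)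
    ((continuous_const.mul hb).intervalIntegrable _ _)
  rw [← map_sub]
  refine (hM _ (le_max_right _ _) _).trans ?_
  gcongr
  exact h s ⟨hs.1.le, hs.2⟩

theorem mul_integral_exp_mul (γ t : ℝ) :
    γ * ∫ s in (0 : ℝ)..t, Real.exp (γ * s) = Real.exp (γ * t) - 1 := by
  rw [← intervalIntegral.integral_const_mul]
  have h : ∀ s, HasDerivAt (fun s => Real.exp (γ * s)) (γ * Real.exp (γ * s)) s := fun s => by
    have := ((hasDerivAt_id s).const_mul γ).exp
    simpa [mul_comm] using this
  rw [intervalIntegral.integral_eq_sub_of_hasDerivAt (fun s _ => h s)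
    (Continuous.intervalIntegrable (by fun_prop) _ _)]
  simp

variable [CompleteSpace X]

/-- Global existence of mild solutions for a Lipschitz nonlinearity. -/
theorem exists_eq_duhamel {M : ℝ} (hM0 : 0 ≤ M)
    (hj : Continuous fun p : ℝ × X => S (max p.1 0) p.2)
    (hM : ∀ t, 0 ≤ t → ∀ x, ‖S t x‖ ≤ M * ‖x‖) {G : ℝ → X → X}
    (hG : Continuous fun p : ℝ × X => G p.1 p.2) {L : ℝ} (hL0 : 0 ≤ L)
    (hL : ∀ s x y, ‖G s x - G s y‖ ≤ L * ‖x - y‖) {T : ℝ} (hT : 0 ≤ T) (z₀ : X) :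
    ∃ z : ℝ → X, Continuous z ∧ ∀ t ∈ Icc 0 T, z t = duhamel S z₀ (fun s => G s (z s)) t := by
  -- In the norm weighted by `e^{-γt}` the map has Lipschitz constant at most `ML/γ`, below `1/2`;
  -- the `+ 1` keeps `γ` positive when `ML = 0`.
  set γ : ℝ := 2 * (M * L) + 1 with hγ
  have hγ0 : 0 < γ := by positivity
  -- Undoes the exponential weight: fixed points are sought for `e^{-γs} z(s)`.
  let ex : C(Icc (0 : ℝ) T, X) → ℝ → X := fun u s => Real.exp (γ * s) • IccExtend hT u s
  have hex : ∀ u, Continuous (ex u) := fun u =>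
    (by fun_prop : Continuous fun s => Real.exp (γ * s)).smul u.continuous.Icc_extend'
  have hGex : ∀ u, Continuous fun s => G s (ex u s) := fun u =>
    hG.comp (continuous_id.prodMk (hex u))
  have hdc : ∀ u, Continuous (duhamel S z₀ fun s => G s (ex u s)) := fun u =>
    continuous_duhamel hj z₀ (hGex u)
  let Φ : C(Icc (0 : ℝ) T, X) → C(Icc (0 : ℝ) T, X) := fun u =>
    ⟨fun t => Real.exp (-(γ * t)) • duhamel S z₀ (fun s => G s (ex u s)) t,
      (by fun_prop : Continuous fun t : Icc (0 : ℝ) T => Real.exp (-(γ * t))).smul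
        ((hdc u).comp continuous_subtype_val)⟩
  have hΦ : ContractingWith (1 / 2) Φ := by
    refine ⟨by norm_num, LipschitzWith.of_dist_le_mul fun u w => ?_⟩
    rw [ContinuousMap.dist_le (by positivity)]
    rintro ⟨t, ht⟩
    have h1 : ‖duhamel S z₀ (fun s => G s (ex u s)) t - duhamel S z₀ (fun s => G s (ex w s)) t‖ ≤
        M * ∫ s in (0 : ℝ)..t, L * dist u w * Real.exp (γ * s) := by
      refine norm_duhamel_sub_le hM0 hj hM z₀ (hGex u) (hGex w) (by fun_prop) ht.1 fun s hs => ?_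
      refine (hL _ _ _).trans ?_
      rw [mul_assoc]
      gcongr
      simp only [ex, ← smul_sub]
      rw [norm_smul, Real.norm_of_nonneg (Real.exp_nonneg _), mul_comm]
      gcongr
      rw [← dist_eq_norm]
      exact ContinuousMap.dist_apply_le_dist _
    rw [intervalIntegral.integral_const_mul] at h1
    have h2 := mul_integral_exp_mul γ t
    set I := ∫ s in (0 : ℝ)..t, Real.exp (γ * s)
    have hI0 : 0 ≤ I := intervalIntegral.integral_nonneg ht.1 fun s _ => Real.exp_nonneg _
    have h3 : M * (L * dist u w * I) ≤ 1 / 2 * dist u w * Real.exp (γ * t) := by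
      have : 2 * (M * L) * I ≤ Real.exp (γ * t) := by
        rw [hγ, add_mul] at h2
        linarith
      calc M * (L * dist u w * I) = 1 / 2 * dist u w * (2 * (M * L) * I) := by ring
        _ ≤ _ := by gcongr
    change dist (Real.exp (-(γ * t)) • duhamel S z₀ (fun s => G s (ex u s)) t)
      (Real.exp (-(γ * t)) • duhamel S z₀ (fun s => G s (ex w s)) t) ≤ _
    rw [dist_eq_norm, ← smul_sub, norm_smul, Real.norm_of_nonneg (Real.exp_nonneg _)]
    calc _ ≤ Real.exp (-(γ * t)) * (1 / 2 * dist u w * Real.exp (γ * t)) := by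
          gcongr
          exact h1.trans h3
      _ = 1 / 2 * dist u w * (Real.exp (-(γ * t)) * Real.exp (γ * t)) := by ring
      _ = 1 / 2 * dist u w := by rw [← Real.exp_add]; simp
      _ = _ := by simp
  obtain ⟨u, hu, -⟩ := hΦ.exists_fixedPoint 0 (edist_ne_top _ _)
  refine ⟨ex u, hex u, fun t ht => ?_⟩
  have h1 : u ⟨t, ht⟩ = Real.exp (-(γ * t)) • duhamel S z₀ (fun s => G s (ex u s)) t := by
    conv_lhs => rw [← hu]
    rfl
  simp only [ex]
  rw [IccExtend_of_mem _ _ ht, h1, smul_smul, ← Real.exp_add]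
  simp [ex]

end Existence

end TirePDE

noncomputable section

namespace TirePDE

instance isProbabilityMeasure_μI : IsProbabilityMeasure μI := ⟨by simp⟩

/-! ### Multiplication operators and kernel functionals on `L²`. -/

section Multiplication

theorem continuous_act : Continuous (act : M2 → R2 →L[ℝ] R2) :=
  LinearMap.continuous_of_finiteDimensional
    (Matrix.toEuclideanCLM (n := Fin 2) (𝕜 := ℝ)).toAlgEquiv.toLinearMap

theorem act_mul_apply (M N : M2) (x : R2) : act (M * N) x = act M (act N x) := by
  simp [act]

theorem inner_act_comm {M : M2} (hM : M.IsSymm) (x y : R2) :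
    inner ℝ (act M x) y = inner ℝ x (act M y) := by
  rw [← ContinuousLinearMap.adjoint_inner_right, ← ContinuousLinearMap.star_eq_adjoint, act,
    ← map_star, Matrix.star_eq_conjTranspose, Matrix.conjTranspose_eq_transpose_of_trivial, hM.eq]

theorem inner_act_pos {M : M2} (hM : M.PosDef) {x : R2} (hx : x ≠ 0) :
    0 < inner ℝ x (act M x) := by
  have h := hM.dotProduct_mulVec_pos (x := x.ofLp) (by simpa using hx)
  simpa [EuclideanSpace.inner_eq_star_dotProduct, act, dotProduct_comm,
    Matrix.ofLp_toEuclideanCLM] using h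

variable {K : ℝ → M2}

theorem ae_mem_Icc : ∀ᵐ ξ ∂μI, ξ ∈ Icc (0 : ℝ) 1 :=
  (ae_restrict_mem measurableSet_Ioo).mono fun _ h => Ioo_subset_Icc_self h

theorem continuousOn_act_comp (hK : ContinuousOn K (Icc 0 1)) :
    ContinuousOn (fun ξ => act (K ξ)) (Icc 0 1) :=
  continuous_act.comp_continuousOn hK

theorem exists_norm_act_le (hK : ContinuousOn K (Icc 0 1)) :
    ∃ C : ℝ, 0 ≤ C ∧ ∀ ξ ∈ Icc (0 : ℝ) 1, ‖act (K ξ)‖ ≤ C := by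
  obtain ⟨C, hC⟩ := isCompact_Icc.exists_bound_of_continuousOn (continuousOn_act_comp hK)
  exact ⟨C, (norm_nonneg _).trans (hC 0 (by simp)), hC⟩

theorem memLp_act (hK : ContinuousOn K (Icc 0 1)) {f : ℝ → R2} (hf : MemLp f 2 μI) :
    MemLp (fun ξ => act (K ξ) (f ξ)) 2 μI := by
  obtain ⟨C, hC0, hC⟩ := exists_norm_act_le hK
  refine MemLp.of_le_mul (c := C) hf ?_ ?_
  · have h1 : AEStronglyMeasurable (fun ξ => act (K ξ)) μI :=
      ((continuousOn_act_comp hK).mono Ioo_subset_Icc_self).aestronglyMeasurable measurableSet_Ioo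
    exact (isBoundedBilinearMap_apply (𝕜 := ℝ) (E := R2) (F := R2)).continuous.comp_aestronglyMeasurable
      (h1.prodMk hf.1)
  · filter_upwards [ae_mem_Icc] with ξ hξ
    exact (act (K ξ)).le_of_opNorm_le (hC ξ hξ) _

/-- Multiplication by a continuous matrix-valued function, as an operator on `L²`. -/
def mulOp (K : ℝ → M2) (hK : ContinuousOn K (Icc 0 1)) : L2 →L[ℝ] L2 :=
  LinearMap.mkContinuous
    { toFun := fun ζ => (memLp_act hK (Lp.memLp ζ)).toLp _
      map_add' := fun ζ η => by
        rw [← MemLp.toLp_add]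
        refine MemLp.toLp_congr _ _ ?_
        filter_upwards [Lp.coeFn_add ζ η] with ξ h
        rw [h, Pi.add_apply, map_add, Pi.add_apply]
      map_smul' := fun a ζ => by
        rw [RingHom.id_apply, ← MemLp.toLp_const_smul]
        refine MemLp.toLp_congr _ _ ?_
        filter_upwards [Lp.coeFn_smul a ζ] with ξ h
        rw [h, Pi.smul_apply, map_smul, Pi.smul_apply] }
    (exists_norm_act_le hK).choose fun ζ => by
      obtain ⟨-, hC⟩ := (exists_norm_act_le hK).choose_spec
      refine Lp.norm_le_mul_norm_of_ae_le_mul ?_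
      filter_upwards [ae_mem_Icc, (memLp_act hK (Lp.memLp ζ)).coeFn_toLp] with ξ hξ h
      simp only [LinearMap.coe_mk, AddHom.coe_mk]
      rw [h]
      exact (act (K ξ)).le_of_opNorm_le (hC ξ hξ) _

theorem coeFn_mulOp (hK : ContinuousOn K (Icc 0 1)) (ζ : L2) :
    mulOp K hK ζ =ᵐ[μI] fun ξ => act (K ξ) (ζ ξ) :=
  (memLp_act hK (Lp.memLp ζ)).coeFn_toLp

theorem inner_mulOp (hK : ContinuousOn K (Icc 0 1)) (ζ η : L2) :
    inner ℝ ζ (mulOp K hK η) = ∫ ξ in Ioo (0 : ℝ) 1, inner ℝ (ζ ξ) (act (K ξ) (η ξ)) := by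
  rw [L2.inner_def]
  refine integral_congr_ae ?_
  filter_upwards [coeFn_mulOp hK η] with ξ h
  rw [h]

theorem integrable_Lp (ζ : L2) : Integrable ζ μI := (Lp.memLp ζ).integrable one_le_two

theorem integrable_act (hK : ContinuousOn K (Icc 0 1)) (ζ : L2) :
    Integrable (fun ξ => act (K ξ) (ζ ξ)) μI :=
  (memLp_act hK (Lp.memLp ζ)).integrable one_le_two

theorem norm_integral_Lp_le (ζ : L2) : ‖∫ ξ, ζ ξ ∂μI‖ ≤ ‖ζ‖ := by
  have h : ‖∫ ξ, ζ ξ ∂μI‖ₑ ≤ eLpNorm ζ 2 μI := by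
    refine (enorm_integral_le_lintegral_enorm _).trans ?_
    rw [← eLpNorm_one_eq_lintegral_enorm]
    exact eLpNorm_le_eLpNorm_of_exponent_le (by norm_num) (Lp.aestronglyMeasurable ζ)
  rw [Lp.norm_def, ← toReal_enorm]
  exact ENNReal.toReal_mono (Lp.eLpNorm_ne_top ζ) h

/-- `kernelInt` as a continuous linear map. -/
def kernelIntL (K : ℝ → M2) (hK : ContinuousOn K (Icc 0 1)) : L2 →L[ℝ] R2 :=
  LinearMap.mkContinuous
    { toFun := fun ζ => ∫ ξ, mulOp K hK ζ ξ ∂μI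
      map_add' := fun ζ η => by
        rw [← integral_add (integrable_Lp _) (integrable_Lp _), map_add]
        exact integral_congr_ae (Lp.coeFn_add _ _)
      map_smul' := fun a ζ => by
        rw [RingHom.id_apply, ← integral_smul, map_smul]
        exact integral_congr_ae (Lp.coeFn_smul _ _) }
    ‖mulOp K hK‖ fun ζ => (norm_integral_Lp_le _).trans ((mulOp K hK).le_opNorm ζ)

theorem kernelIntL_apply (hK : ContinuousOn K (Icc 0 1)) (ζ : L2) :
    kernelIntL K hK ζ = kernelInt K ζ :=
  integral_congr_ae (coeFn_mulOp hK ζ)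

/-- The coercivity constant is the minimum of `xᵀ K(ξ) x` over the compact set `[0,1]` times the
unit sphere. -/
theorem isInnerWeight_mulOp (hK : ContinuousOn K (Icc 0 1))
    (hpos : ∀ ξ ∈ Icc (0 : ℝ) 1, (K ξ).PosDef) : IsInnerWeight (mulOp K hK) where
  symm ζ η := by
    rw [real_inner_comm, inner_mulOp, inner_mulOp]
    refine integral_congr_ae ?_
    filter_upwards [ae_mem_Icc] with ξ hξ
    have hs : (K ξ).IsSymm := by
      have := (hpos ξ hξ).isHermitian
      rwa [Matrix.IsHermitian, Matrix.conjTranspose_eq_transpose_of_trivial] at this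
    rw [real_inner_comm, inner_act_comm hs]
  coercive := by
    obtain ⟨c, hc, h⟩ : ∃ c : ℝ, 0 < c ∧ ∀ ξ ∈ Icc (0 : ℝ) 1, ∀ x : R2,
        c * ‖x‖ ^ 2 ≤ inner ℝ x (act (K ξ) x) := by
      have hcomp : IsCompact (Icc (0 : ℝ) 1 ×ˢ Metric.sphere (0 : R2) 1) :=
        isCompact_Icc.prod (isCompact_sphere _ _)
      have hne : (Icc (0 : ℝ) 1 ×ˢ Metric.sphere (0 : R2) 1).Nonempty :=
        ⟨(0, EuclideanSpace.single 0 1), by simp⟩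
      have hcont : ContinuousOn (fun p : ℝ × R2 => inner ℝ p.2 (act (K p.1) p.2))
          (Icc (0 : ℝ) 1 ×ˢ Metric.sphere (0 : R2) 1) := by
        have h1 : ContinuousOn (fun p : ℝ × R2 => act (K p.1))
            (Icc (0 : ℝ) 1 ×ˢ Metric.sphere (0 : R2) 1) :=
          (continuousOn_act_comp hK).comp continuousOn_fst fun p hp => hp.1
        exact continuousOn_snd.inner (h1.clm_apply continuousOn_snd)
      obtain ⟨⟨ξ₀, x₀⟩, ⟨hξ₀, hx₀⟩, hmin⟩ := hcomp.exists_isMinOn hne hcont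
      refine ⟨inner ℝ x₀ (act (K ξ₀) x₀), inner_act_pos (hpos _ hξ₀) ?_, fun ξ hξ x => ?_⟩
      · rintro rfl
        simp at hx₀
      · rcases eq_or_ne x 0 with rfl | hx
        · simp
        · have hn : ‖x‖ ≠ 0 := norm_ne_zero_iff.2 hx
          have hmem : (ξ, ‖x‖⁻¹ • x) ∈ Icc (0 : ℝ) 1 ×ˢ Metric.sphere (0 : R2) 1 :=
            ⟨hξ, by simp [norm_smul, hn]⟩
          have h2 := hmin hmem
          simp only [mem_ofPred_eq, map_smul, real_inner_smul_left, real_inner_smul_right] at h2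
          calc _ ≤ ‖x‖⁻¹ * (‖x‖⁻¹ * inner ℝ x (act (K ξ) x)) * ‖x‖ ^ 2 := by gcongr
            _ = _ := by field_simp
    refine ⟨c, hc, fun ζ => ?_⟩
    have h1 : c * ‖ζ‖ ^ 2 = ∫ ξ, c * ‖ζ ξ‖ ^ 2 ∂μI := by
      rw [integral_const_mul, ← real_inner_self_eq_norm_sq, L2.inner_def]
      simp
    rw [h1, L2.inner_def]
    refine integral_mono_ae ?_ (L2.integrable_inner _ _) ?_
    · have := (L2.integrable_inner (𝕜 := ℝ) ζ ζ).const_mul c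
      simpa using this
    · filter_upwards [ae_mem_Icc, coeFn_mulOp hK ζ] with ξ hξ h2
      rw [h2]
      exact h ξ hξ _

end Multiplication

end TirePDE

end

noncomputable section

namespace TirePDE

/-! ### Weak derivatives and the graph of `𝒜`. -/

section WeakDerivative

theorem integrable_smul_of_continuous {φ : ℝ → ℝ} (hφ : Continuous φ) {f : ℝ → R2}
    (hf : Integrable f μI) : Integrable (fun ξ => φ ξ • f ξ) μI :=
  IntegrableOn.continuousOn_smul_of_subset hφ.continuousOn hf isCompact_Icc measurableSet_Ioo
    Ioo_subset_Icc_self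

theorem memLp_of_continuousOn {w : ℝ → R2} (hw : ContinuousOn w (Icc 0 1)) : MemLp w 2 μI := by
  obtain ⟨C, hC⟩ := isCompact_Icc.exists_bound_of_continuousOn hw
  refine MemLp.of_bound ((hw.mono Ioo_subset_Icc_self).aestronglyMeasurable measurableSet_Ioo) C ?_
  filter_upwards [ae_mem_Icc] with ξ hξ
  exact hC ξ hξ

theorem HasWeakDeriv.add {ζ g ζ' g' : L2} (h : HasWeakDeriv ζ g) (h' : HasWeakDeriv ζ' g') :
    HasWeakDeriv (ζ + ζ') (g + g') := by
  intro φ h1 h2 h3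
  have hd : Continuous (deriv φ) := h1.continuous_deriv (by simp)
  have e : ∀ (ψ : ℝ → ℝ), Continuous ψ → ∀ a b : L2, ∫ ξ in Ioo (0 : ℝ) 1, ψ ξ • (a + b) ξ =
      (∫ ξ in Ioo (0 : ℝ) 1, ψ ξ • a ξ) + ∫ ξ in Ioo (0 : ℝ) 1, ψ ξ • b ξ := by
    intro ψ hψ a b
    rw [← integral_add (integrable_smul_of_continuous hψ (integrable_Lp a))
      (integrable_smul_of_continuous hψ (integrable_Lp b))]
    refine integral_congr_ae ?_
    filter_upwards [Lp.coeFn_add a b] with ξ hξ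
    rw [hξ, Pi.add_apply, smul_add]
  rw [e _ hd, e _ h1.continuous, h φ h1 h2 h3, h' φ h1 h2 h3, neg_add]

theorem HasWeakDeriv.smul {ζ g : L2} (h : HasWeakDeriv ζ g) (a : ℝ) :
    HasWeakDeriv (a • ζ) (a • g) := by
  intro φ h1 h2 h3
  have e : ∀ (ψ : ℝ → ℝ) (b : L2), ∫ ξ in Ioo (0 : ℝ) 1, ψ ξ • (a • b) ξ =
      a • ∫ ξ in Ioo (0 : ℝ) 1, ψ ξ • b ξ := by
    intro ψ b
    rw [← integral_smul]
    refine integral_congr_ae ?_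
    filter_upwards [Lp.coeFn_smul a b] with ξ hξ
    rw [hξ, Pi.smul_apply, smul_comm]
  rw [e, e, h φ h1 h2 h3, smul_neg]

/-- The fundamental lemma of the calculus of variations; it makes `𝒜` single-valued. -/
theorem HasWeakDeriv.eq_zero {g : L2} (h : HasWeakDeriv 0 g) : g = 0 := by
  have h1 : ∀ᵐ ξ ∂volume, ξ ∈ Ioo (0 : ℝ) 1 → g ξ = 0 := by
    refine isOpen_Ioo.ae_eq_zero_of_integral_contDiff_smul_eq_zero
      (IntegrableOn.locallyIntegrableOn (integrable_Lp g)) fun φ h1 h2 h3 => ?_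
    have h4 := h φ h1 h2 h3
    have h5 : ∫ ξ in Ioo (0 : ℝ) 1, deriv φ ξ • (0 : L2) ξ = 0 := by
      rw [← integral_zero ℝ R2 (μ := μI)]
      refine integral_congr_ae ?_
      filter_upwards [Lp.coeFn_zero R2 2 μI] with ξ hξ
      rw [hξ, Pi.zero_apply, smul_zero]
    rw [h5, eq_comm, neg_eq_zero] at h4
    rw [← h4, setIntegral_eq_integral_of_forall_compl_eq_zero]
    intro ξ hξ
    rw [image_eq_zero_of_notMem_tsupport fun hmem => hξ (h3 hmem), zero_smul]
  rw [Lp.eq_zero_iff_ae_eq_zero]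
  exact (ae_restrict_iff' measurableSet_Ioo).2 h1

theorem eq_of_ae_eq_of_continuousOn {w w' : ℝ → R2} (hw : ContinuousOn w (Icc 0 1))
    (hw' : ContinuousOn w' (Icc 0 1)) (h : w =ᵐ[μI] w') : ∀ ξ ∈ Icc (0 : ℝ) 1, w ξ = w' ξ := by
  refine Measure.eqOn_Icc_of_ae_eq (μ := volume) zero_ne_one ?_ hw hw'
  rwa [← restrict_Ioo_eq_restrict_Icc]

/-- An `L²` function is the weak derivative of its primitive. -/
theorem hasWeakDeriv_of_primitive {ζ g : L2} {w : ℝ → R2} (hζ : ζ =ᵐ[μI] w)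
    (hw : ∀ x ∈ Icc (0 : ℝ) 1, w x = ∫ s in (0 : ℝ)..x, g s) : HasWeakDeriv ζ g := by
  intro φ h1 h2 h3
  have hd : Continuous (deriv φ) := h1.continuous_deriv (by simp)
  have hdi : Integrable (deriv φ) μI :=
    (hd.integrableOn_Icc (a := 0) (b := 1)).mono_set Ioo_subset_Icc_self
  have hφ1 : φ 1 = 0 := image_eq_zero_of_notMem_tsupport fun h => by simpa using h3 h
  -- Fubini on the triangle `s < x` for `φ'(x) g(s)`: integrating in `s` gives `φ'(x) w(x)`, and in
  -- `x` gives `(φ(1) - φ(s)) g(s) = -φ(s) g(s)`.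
  let F : ℝ → ℝ → R2 := fun x s => {p : ℝ × ℝ | p.2 < p.1}.indicator
    (fun p => deriv φ p.1 • g p.2) (x, s)
  have hF : Integrable (Function.uncurry F) (μI.prod μI) :=
    (hdi.smul_prod (integrable_Lp g)).indicator (measurableSet_lt measurable_snd measurable_fst)
  have hswap := integral_integral_swap hF
  have hL : ∀ x ∈ Ioo (0 : ℝ) 1, ∫ s, F x s ∂μI = deriv φ x • w x := by
    intro x hx
    have e : F x = (Iio x).indicator fun s => deriv φ x • g s := by
      ext1 s
      simp only [F, indicator, mem_ofPred_eq, mem_Iio]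
    rw [e, setIntegral_indicator measurableSet_Iio, Ioo_inter_Iio, min_eq_right hx.2.le,
      integral_smul, hw x ⟨hx.1.le, hx.2.le⟩, intervalIntegral.integral_of_le hx.1.le,
      integral_Ioc_eq_integral_Ioo]
  have hR : ∀ s ∈ Ioo (0 : ℝ) 1, ∫ x, F x s ∂μI = -(φ s • g s) := by
    intro s hs
    have e : (fun x => F x s) = (Ioi s).indicator fun x => deriv φ x • g s := by
      ext1 x
      simp only [F, indicator, mem_ofPred_eq, mem_Ioi]
    rw [e, setIntegral_indicator measurableSet_Ioi, Ioo_inter_Ioi, max_eq_right hs.1.le,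
      integral_smul_const, ← integral_Ioc_eq_integral_Ioo,
      ← intervalIntegral.integral_of_le hs.2.le, intervalIntegral.integral_deriv_eq_sub
        (fun x _ => (h1.differentiable (by simp)).differentiableAt)
        (hd.intervalIntegrable _ _), hφ1, zero_sub, neg_smul]
  rw [setIntegral_congr_fun measurableSet_Ioo hL, setIntegral_congr_fun measurableSet_Ioo hR,
    integral_neg] at hswap
  rw [← hswap]
  refine integral_congr_ae ?_
  filter_upwards [hζ] with ξ hξ
  rw [hξ]

end WeakDerivative

namespace TransportSystem

variable (P : TransportSystem)

theorem isA_add {ζ η ζ' η' : L2} (h : P.IsA ζ η) (h' : P.IsA ζ' η') :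
    P.IsA (ζ + ζ') (η + η') := by
  obtain ⟨g, w, hg, ⟨hwc, hw⟩, hw0, hη⟩ := h
  obtain ⟨g', w', hg', ⟨hwc', hw'⟩, hw0', hη'⟩ := h'
  refine ⟨g + g', w + w', hg.add hg', ⟨hwc.add hwc', ?_⟩, by simp [hw0, hw0'], ?_⟩
  · filter_upwards [Lp.coeFn_add ζ ζ', hw, hw'] with ξ h1 h2 h3
    simp only [h1, Pi.add_apply, h2, h3]
  · filter_upwards [Lp.coeFn_add η η', Lp.coeFn_add g g', hη, hη'] with ξ h1 h2 h3 h4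
    rw [← kernelIntL_apply P.continuousOn_K₃, map_add, h1, h2, Pi.add_apply, Pi.add_apply,
      Pi.add_apply, h3, h4, kernelIntL_apply, kernelIntL_apply, map_add, map_add]
    abel

theorem isA_smul {ζ η : L2} (h : P.IsA ζ η) (a : ℝ) : P.IsA (a • ζ) (a • η) := by
  obtain ⟨g, w, hg, ⟨hwc, hw⟩, hw0, hη⟩ := h
  refine ⟨a • g, a • w, hg.smul a, ⟨hwc.const_smul a, ?_⟩, by simp [hw0], ?_⟩
  · filter_upwards [Lp.coeFn_smul a ζ, hw] with ξ h1 h2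
    simp only [h1, Pi.smul_apply, h2]
  · filter_upwards [Lp.coeFn_smul a η, Lp.coeFn_smul a g, hη] with ξ h1 h2 h3
    rw [← kernelIntL_apply P.continuousOn_K₃, map_smul, h1, h2, Pi.smul_apply, Pi.smul_apply,
      Pi.smul_apply, h3, kernelIntL_apply, map_smul, map_smul]
    simp only [smul_add, smul_neg]

theorem isA_single {η : L2} (h : P.IsA 0 η) : η = 0 := by
  obtain ⟨g, w, hg, ⟨hwc, hw⟩, hw0, hη⟩ := h
  have hg0 := hg.eq_zero
  subst hg0
  have hw1 : w 1 = 0 := by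
    refine eq_of_ae_eq_of_continuousOn hwc continuousOn_const ?_ 1 (by simp)
    exact hw.symm.trans (Lp.coeFn_zero R2 2 μI)
  rw [Lp.eq_zero_iff_ae_eq_zero]
  filter_upwards [hη, Lp.coeFn_zero R2 2 μI] with ξ h1 h2
  rw [h1, h2, hw1, ← kernelIntL_apply P.continuousOn_K₃]
  simp

theorem isA_of_primitive {ζ g η : L2} {w : ℝ → R2} (hwc : ContinuousOn w (Icc 0 1))
    (hζ : ζ =ᵐ[μI] w) (hw : ∀ x ∈ Icc (0 : ℝ) 1, w x = ∫ s in (0 : ℝ)..x, g s)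
    (hη : η =ᵐ[μI] fun ξ => -act P.Λ (g ξ) + (kernelInt P.K₃ ζ + act P.K₄ (w 1))) :
    P.IsA ζ η :=
  ⟨g, w, hasWeakDeriv_of_primitive hζ hw, ⟨hwc, hζ⟩, by simpa using hw 0 (by simp), hη⟩

end TransportSystem

end TirePDE

end

noncomputable section

namespace TirePDE

/-! ### The resolvent equation for `𝒜`. -/

section ConstSol

variable {X : Type*} [NormedAddCommGroup X] [InnerProductSpace ℝ X] [CompleteSpace X]

/-- The solution operator of `w' = T (c - l w)`, `w(0) = 0`, for constant `c`. -/
def constSol (T : X →L[ℝ] X) (l x : ℝ) : X →L[ℝ] X :=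
  l⁻¹ • (1 - NormedSpace.exp (x • (-l) • T))

theorem continuous_constSol (T : X →L[ℝ] X) (l : ℝ) : Continuous (constSol T l) :=
  (continuous_const.sub (continuous_exp_smul ((-l) • T))).const_smul l⁻¹

theorem hasDerivAt_constSol (T : X →L[ℝ] X) {l : ℝ} (hl : l ≠ 0) (c : X) (x : ℝ) :
    HasDerivAt (fun x => constSol T l x c) (T (c - l • constSol T l x c)) x := by
  have h1 := (hasDerivAt_exp_smul_const' (𝕂 := ℝ) ((-l) • T) x).const_sub 1
  have h2 := (h1.const_smul l⁻¹).clm_apply (hasDerivAt_const x c)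
  refine h2.congr_deriv ?_
  have h3 : c - l • constSol T l x c = NormedSpace.exp (x • (-l) • T) c := by
    simp [constSol, smul_smul, mul_inv_cancel₀ hl]
  rw [h3]
  simp [smul_smul, inv_mul_cancel₀ hl]

theorem constSol_eq_integral (T : X →L[ℝ] X) {l : ℝ} (hl : l ≠ 0) (c : X) (x : ℝ) :
    constSol T l x c = ∫ s in (0 : ℝ)..x, T (c - l • constSol T l s c) := by
  have hc : Continuous fun x => constSol T l x c :=
    (continuous_constSol T l).clm_apply continuous_const
  rw [intervalIntegral.integral_eq_sub_of_hasDerivAt (fun s _ => hasDerivAt_constSol T hl c s)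
    (Continuous.intervalIntegrable (by fun_prop) _ _)]
  simp [constSol]

end ConstSol

namespace TransportSystem

variable (P : TransportSystem)

theorem act_Λ_inv (x : R2) : act P.Λ (act P.Λ⁻¹ x) = x := by
  rw [← act_mul_apply, Matrix.mul_nonsing_inv _ ((Matrix.isUnit_iff_isUnit_det _).1
    P.posDef_Λ.isUnit)]
  simp [act]

/-- `h` and its primitive, for `h ∈ L²`, extended to a continuous function on the line. -/
theorem exists_continuous_primitive (h : L2) : ∃ p : ℝ → R2, Continuous p ∧
    ∀ x ∈ Icc (0 : ℝ) 1, p x = ∫ s in (0 : ℝ)..x, h s := by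
  have hi : Integrable ((Ioo (0 : ℝ) 1).indicator h) :=
    (integrable_indicator_iff measurableSet_Ioo).2 (integrable_Lp h)
  refine ⟨fun x => ∫ s in (0 : ℝ)..x, (Ioo (0 : ℝ) 1).indicator h s,
    intervalIntegral.continuous_primitive (fun a b => hi.intervalIntegrable) 0, fun x hx => ?_⟩
  simp only [intervalIntegral.integral_of_le hx.1, integral_Ioc_eq_integral_Ioo]
  refine setIntegral_congr_fun measurableSet_Ioo fun s hs => ?_
  exact indicator_of_mem (show s ∈ Ioo (0 : ℝ) 1 from ⟨hs.1, hs.2.trans_le hx.2⟩) _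

/-- The linear initial value problem `w' = h + M w`, `w(0) = 0`, with `h ∈ L²`. -/
theorem exists_primitive_add (M : R2 →L[ℝ] R2) (h : L2) : ∃ w : ℝ → R2, Continuous w ∧
    ∀ x ∈ Icc (0 : ℝ) 1, w x = ∫ s in (0 : ℝ)..x, (h s + M (w s)) := by
  obtain ⟨p, hp, hph⟩ := exists_continuous_primitive h
  -- Subtracting the primitive `p` leaves `u' = M(u + p)` with continuous right-hand side: the fixed
  -- point theorem applies with the identity as semigroup.
  obtain ⟨u, hu, hu'⟩ := exists_eq_duhamel (S := fun _ => ContinuousLinearMap.id ℝ R2) (M := 1)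
    zero_le_one (by fun_prop) (fun _ _ x => by simp) (G := fun s x => M (x + p s)) (by fun_prop)
    (norm_nonneg M) (fun s x y => by
      rw [← map_sub, add_sub_add_right_eq_sub]
      exact M.le_opNorm _) zero_le_one 0
  refine ⟨fun x => p x + u x, hp.add hu, fun x hx => ?_⟩
  have hint : IntervalIntegrable h volume 0 x := by
    rw [intervalIntegrable_iff_integrableOn_Ioo_of_le hx.1]
    exact IntegrableOn.mono_set (integrable_Lp h) (Ioo_subset_Ioo_right hx.2)
  rw [intervalIntegral.integral_add hint (Continuous.intervalIntegrable (by fun_prop) _ _),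
    ← hph x hx]
  simp only [hu' x hx, duhamel, map_zero, zero_add, ContinuousLinearMap.id_apply, add_comm (p _)]

/-- `𝒦₃ w` for a continuous function `w`. -/
def feedback (w : ℝ → R2) : R2 :=
  (∫ ξ in Ioo (0 : ℝ) 1, act (P.K₃ ξ) (w ξ)) + act P.K₄ (w 1)

theorem integrable_act_continuous {K : ℝ → M2} (hK : ContinuousOn K (Icc 0 1)) {w : ℝ → R2}
    (hw : Continuous w) : Integrable (fun ξ => act (K ξ) (w ξ)) μI :=
  (memLp_act hK (memLp_of_continuousOn hw.continuousOn)).integrable one_le_two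

theorem feedback_add {w w' : ℝ → R2} (hw : Continuous w) (hw' : Continuous w') :
    P.feedback (fun ξ => w ξ + w' ξ) = P.feedback w + P.feedback w' := by
  simp only [feedback, map_add]
  rw [integral_add (integrable_act_continuous P.continuousOn_K₃ hw)
    (integrable_act_continuous P.continuousOn_K₃ hw')]
  abel

theorem feedback_smul (a : ℝ) (w : ℝ → R2) :
    P.feedback (fun ξ => a • w ξ) = a • P.feedback w := by
  simp only [feedback, map_smul, integral_smul, smul_add]

theorem feedback_eq {ζ : L2} {w : ℝ → R2} (h : ζ =ᵐ[μI] w) :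
    kernelInt P.K₃ ζ + act P.K₄ (w 1) = P.feedback w := by
  unfold feedback kernelInt
  congr 1
  refine integral_congr_ae ?_
  filter_upwards [h] with ξ hξ
  rw [hξ]

/-- The boundary value problem for the resolvent of `𝒜` in integrated form. -/
theorem isA_of_integral_eq {l : ℝ} {f : L2} {w : ℝ → R2} (hwc : Continuous w)
    (hw : ∀ x ∈ Icc (0 : ℝ) 1,
      w x = ∫ s in (0 : ℝ)..x, act P.Λ⁻¹ (f s + P.feedback w - l • w s)) :
    ∃ ζ : L2, ζ =ᵐ[μI] w ∧ P.IsA ζ (l • ζ - f) := by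
  have hm := memLp_of_continuousOn hwc.continuousOn
  have hgm : MemLp (fun s => act P.Λ⁻¹ (f s + P.feedback w - l • w s)) 2 μI :=
    (act P.Λ⁻¹).comp_memLp' (((Lp.memLp f).add (memLp_const _)).sub (hm.const_smul l))
  refine ⟨hm.toLp w, hm.coeFn_toLp, P.isA_of_primitive (g := hgm.toLp _) hwc.continuousOn
    hm.coeFn_toLp (fun x hx => ?_) ?_⟩
  · rw [hw x hx, intervalIntegral.integral_of_le hx.1, intervalIntegral.integral_of_le hx.1,
      integral_Ioc_eq_integral_Ioo, integral_Ioc_eq_integral_Ioo]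
    refine integral_congr_ae ?_
    exact ae_restrict_of_ae_restrict_of_subset (Ioo_subset_Ioo_right hx.2) hgm.coeFn_toLp.symm
  · rw [P.feedback_eq hm.coeFn_toLp]
    filter_upwards [hgm.coeFn_toLp, hm.coeFn_toLp, Lp.coeFn_sub (l • hm.toLp w) f,
      Lp.coeFn_smul l (hm.toLp w)] with ξ h1 h2 h3 h4
    rw [h1, h3, Pi.sub_apply, h4, Pi.smul_apply, h2, P.act_Λ_inv]
    abel

variable {P} {ω : ℝ}

theorem StrictDissipativity.inner_le (h : P.StrictDissipativity ω)
    (hQ : ContinuousOn P.Q (Icc 0 1)) {ζ η : L2} (hA : P.IsA ζ η) :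
    inner ℝ η (mulOp P.Q hQ ζ) ≤ -ω * ‖ζ‖ ^ 2 := by
  rw [inner_mulOp]
  exact h ζ η hA

variable (P)

theorem continuousOn_Q : ContinuousOn P.Q (Icc 0 1) :=
  P.continuousOn_K₁.mul continuousOn_const

/-- The operator of multiplication by `𝒬`. -/
def weight : L2 →L[ℝ] L2 := mulOp P.Q P.continuousOn_Q

theorem isInnerWeight_weight : IsInnerWeight P.weight :=
  isInnerWeight_mulOp P.continuousOn_Q P.posDef_Q

variable {P}

/-- In `ℝ²` injectivity suffices. A `c` in the kernel would give `ζ` with `𝒜ζ = lζ`, which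
dissipativity forces to vanish. -/
theorem exists_sub_feedback_eq (hω : 0 < ω) (h : P.StrictDissipativity ω) {l : ℝ} (hl : 0 < l)
    (d : R2) : ∃ c : R2, c - P.feedback (fun x => constSol (act P.Λ⁻¹) l x c) = d := by
  have hcont : ∀ c, Continuous fun x => constSol (act P.Λ⁻¹) l x c := fun c =>
    (continuous_constSol (act P.Λ⁻¹) l).clm_apply continuous_const
  let N : R2 →ₗ[ℝ] R2 :=
    { toFun := fun c => c - P.feedback (fun x => constSol (act P.Λ⁻¹) l x c)
      map_add' := fun c c' => by
        simp only [map_add]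
        rw [P.feedback_add (hcont c) (hcont c')]
        abel
      map_smul' := fun a c => by
        simp only [map_smul, RingHom.id_apply]
        rw [P.feedback_smul, smul_sub] }
  refine LinearMap.surjective_of_injective (f := N) ?_ d
  rw [injective_iff_map_eq_zero]
  intro c hc
  have hc' : P.feedback (fun x => constSol (act P.Λ⁻¹) l x c) = c := (sub_eq_zero.1 hc).symm
  obtain ⟨ζ, hζ, hA⟩ := P.isA_of_integral_eq (l := l) (f := 0) (hcont c) fun x hx => by
    rw [hc', constSol_eq_integral (act P.Λ⁻¹) hl.ne' c x, intervalIntegral.integral_of_le hx.1,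
      intervalIntegral.integral_of_le hx.1, integral_Ioc_eq_integral_Ioo,
      integral_Ioc_eq_integral_Ioo]
    refine integral_congr_ae ?_
    filter_upwards [ae_restrict_of_ae_restrict_of_subset (Ioo_subset_Ioo_right hx.2)
      (Lp.coeFn_zero R2 2 μI)] with s hs
    rw [hs, Pi.zero_apply, zero_add]
  have h1 := h.inner_le P.continuousOn_Q hA
  rw [sub_zero, real_inner_smul_left] at h1
  have h2 := P.isInnerWeight_weight.energy_nonneg ζ
  have hζ0 : ζ = 0 := by
    have h3 : 0 ≤ l * inner ℝ ζ (mulOp P.Q P.continuousOn_Q ζ) := mul_nonneg hl.le h2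
    have h4 : ‖ζ‖ ^ 2 ≤ 0 := by
      by_contra! h5
      nlinarith
    simpa using le_antisymm h4 (sq_nonneg _)
  subst hζ0
  have hw0 : ∀ x ∈ Icc (0 : ℝ) 1, constSol (act P.Λ⁻¹) l x c = 0 :=
    eq_of_ae_eq_of_continuousOn (hcont c).continuousOn continuousOn_const
      (hζ.symm.trans (Lp.coeFn_zero R2 2 μI))
  -- At an interior point the vanishing solution has derivative `Λ⁻¹ c`, hence `c = 0`.
  have hd := hasDerivAt_constSol (act P.Λ⁻¹) hl.ne' c (1 / 2)
  have hz : HasDerivAt (fun x => constSol (act P.Λ⁻¹) l x c) 0 (1 / 2) := by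
    refine (hasDerivAt_const (1 / 2 : ℝ) (0 : R2)).congr_of_eventuallyEq ?_
    filter_upwards [Icc_mem_nhds (by norm_num : (0 : ℝ) < 1 / 2) (by norm_num : (1 / 2 : ℝ) < 1)]
      with x hx
    exact hw0 x hx
  have h3 := hd.unique hz
  rw [hw0 (1 / 2) (by norm_num), smul_zero, sub_zero] at h3
  rw [← P.act_Λ_inv c, h3, map_zero]

/-- Superposition: `u` solves the equation without feedback, and the response to a constant `c` is
added. Consistency, `c = 𝒦₃(u + response)`, is the problem in `ℝ²` just solved. -/
theorem isA_surj (hω : 0 < ω) (h : P.StrictDissipativity ω) {l : ℝ} (hl : 0 < l)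
    (f : L2) : ∃ ζ, P.IsA ζ (l • ζ - f) := by
  have hcont : ∀ c, Continuous fun x => constSol (act P.Λ⁻¹) l x c := fun c =>
    (continuous_constSol (act P.Λ⁻¹) l).clm_apply continuous_const
  obtain ⟨u, hu, hu'⟩ := exists_primitive_add ((-l) • act P.Λ⁻¹) ((act P.Λ⁻¹).compLp f)
  obtain ⟨c, hc⟩ := exists_sub_feedback_eq hω h hl (P.feedback u)
  have hfb : P.feedback (fun x => u x + constSol (act P.Λ⁻¹) l x c) = c := by
    rw [P.feedback_add hu (hcont c), ← hc]
    abel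
  obtain ⟨ζ, -, hA⟩ := P.isA_of_integral_eq (l := l) (f := f)
      (w := fun x => u x + constSol (act P.Λ⁻¹) l x c) (hu.add (hcont c)) fun x hx => by
    have hint : IntervalIntegrable f volume 0 x := by
      rw [intervalIntegrable_iff_integrableOn_Ioo_of_le hx.1]
      exact IntegrableOn.mono_set (integrable_Lp f) (Ioo_subset_Ioo_right hx.2)
    have hcongr : ∫ s in (0 : ℝ)..x, ((act P.Λ⁻¹).compLp f s + ((-l) • act P.Λ⁻¹) (u s)) =
        ∫ s in (0 : ℝ)..x, (act P.Λ⁻¹ (f s) + ((-l) • act P.Λ⁻¹) (u s)) := by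
      rw [intervalIntegral.integral_of_le hx.1, intervalIntegral.integral_of_le hx.1,
        integral_Ioc_eq_integral_Ioo, integral_Ioc_eq_integral_Ioo]
      refine integral_congr_ae ?_
      filter_upwards [ae_restrict_of_ae_restrict_of_subset (Ioo_subset_Ioo_right hx.2)
        ((act P.Λ⁻¹).coeFn_compLp' f)] with s hs
      rw [hs]
    have hcc := hcont c
    rw [hu' x hx, hcongr, constSol_eq_integral (act P.Λ⁻¹) hl.ne' c x, hfb,
      ← intervalIntegral.integral_add]
    · refine intervalIntegral.integral_congr fun s _ => ?_
      simp only [map_add, map_sub, map_smul, smul_add, smul_apply, neg_smul]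
      abel
    · refine IntervalIntegrable.add ⟨(act P.Λ⁻¹).integrable_comp hint.1,
        (act P.Λ⁻¹).integrable_comp hint.2⟩ (Continuous.intervalIntegrable (by fun_prop) _ _)
    · exact Continuous.intervalIntegrable (by fun_prop) _ _
  exact ⟨ζ, hA⟩

theorem isMaxDissipative_isA (hω : 0 < ω) (h : P.StrictDissipativity ω) :
    IsMaxDissipative P.weight P.IsA where
  add _ _ _ _ h h' := P.isA_add h h'
  smul a _ _ h := P.isA_smul h a
  dissip ζ η hA := (h.inner_le P.continuousOn_Q hA).trans
    (mul_nonpos_of_nonpos_of_nonneg (by linarith) (sq_nonneg _))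
  single _ h := P.isA_single h
  surj _ hl f := isA_surj hω h hl f

end TransportSystem

end TirePDE

end

noncomputable section

/-! ### The semilinear source, existence and passivity. -/

namespace TirePDE

/-- The pointwise action of a linear map on `L²`, as a bounded bilinear map. -/
def compLpB : (R2 →L[ℝ] R2) →L[ℝ] L2 →L[ℝ] L2 :=
  LinearMap.mkContinuous₂ (LinearMap.mk₂ ℝ (fun (L : R2 →L[ℝ] R2) (ζ : L2) => L.compLp ζ)
    (fun L L' ζ => ContinuousLinearMap.add_compLp L L' ζ)
    (fun a L ζ => ContinuousLinearMap.smul_compLp a L ζ)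
    (fun L ζ ζ' => (L.compLpL 2 μI).map_add ζ ζ')
    (fun a L ζ => (L.compLpL 2 μI).map_smul a ζ)) 1
    (fun L ζ => by
      rw [one_mul]
      exact ContinuousLinearMap.norm_compLp_le L ζ)

theorem compLpB_apply (L : R2 →L[ℝ] R2) (ζ : L2) : compLpB L ζ = L.compLp ζ := rfl

/-- The last clause, that no new values are taken, transfers bounds on `[0,T]` to the whole line. -/
theorem exists_continuous_extension {E : Type*} [TopologicalSpace E] {T : ℝ} (hT : 0 ≤ T)
    {v : ℝ → E} (hv : ContinuousOn v (Icc 0 T)) : ∃ v' : ℝ → E, Continuous v' ∧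
      (∀ s ∈ Icc 0 T, v' s = v s) ∧ ∀ s, ∃ r ∈ Icc 0 T, v' s = v r := by
  refine ⟨IccExtend hT ((Icc 0 T).domRestrict v), hv.domRestrict.Icc_extend', fun s hs => ?_,
    fun s => ⟨projIcc 0 T hT s, (projIcc 0 T hT s).2, rfl⟩⟩
  rw [IccExtend_of_mem _ _ hs]
  rfl

namespace TransportSystem

variable (P : TransportSystem)

/-- The operator `ζ ↦ ζ + 𝒦₂ ζ`. -/
def addMean : L2 →L[ℝ] L2 :=
  ContinuousLinearMap.id ℝ L2 + (Lp.constL 2 μI ℝ).comp (kernelIntL P.K₂ P.continuousOn_K₂)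

theorem source_eq (y : R2) (ζ : L2) : P.source y ζ =
    P.θ • compLpB (act (P.Sig y)) (P.addMean ζ) + Lp.constL 2 μI ℝ (act P.H y) := by
  rw [source, ← kernelIntL_apply P.continuousOn_K₂]
  rfl

theorem continuous_source {Y : Type*} [TopologicalSpace Y] {y : Y → R2} {ζ : Y → L2}
    (hy : Continuous y) (hζ : Continuous ζ) : Continuous fun p => P.source (y p) (ζ p) := by
  simp only [source_eq]
  have h1 : Continuous fun p => compLpB (act (P.Sig (y p))) :=
    compLpB.continuous.comp (continuous_act.comp (P.continuous_Sig.comp hy))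
  exact ((h1.clm_apply (P.addMean.continuous.comp hζ)).const_smul P.θ).add
    ((Lp.constL 2 μI ℝ).continuous.comp ((act P.H).continuous.comp hy))

theorem norm_source_sub_le (y : R2) (ζ ζ' : L2) : ‖P.source y ζ - P.source y ζ'‖ ≤
    P.θ * (‖compLpB‖ * ‖act (P.Sig y)‖ * ‖P.addMean‖) * ‖ζ - ζ'‖ := by
  rw [source_eq, source_eq, add_sub_add_right_eq_sub, ← smul_sub, ← map_sub, ← map_sub, norm_smul,
    Real.norm_of_nonneg P.θ_nonneg, mul_assoc, mul_assoc]
  refine mul_le_mul_of_nonneg_left ?_ P.θ_nonneg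
  refine (compLpB.le_opNorm₂ _ _).trans ?_
  gcongr
  exact P.addMean.le_opNorm _

theorem storage_eq (ζ : L2) : P.storage ζ = 1 / 2 * inner ℝ ζ (P.weight ζ) := by
  rw [weight, inner_mulOp, storage]

theorem continuous_output : Continuous P.output := by
  have : P.output = kernelIntL P.K₁ P.continuousOn_K₁ := by
    ext1 ζ
    rw [kernelIntL_apply, output]
  rw [this]
  exact ContinuousLinearMap.continuous _

/-- `𝒬H = K₁H⁻¹H = K₁`, and `K₁` is symmetric: this choice of weight pairs the input with the
output. -/
theorem inner_weight_const (y : R2) (ζ : L2) :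
    inner ℝ ζ (P.weight (Lp.constL 2 μI ℝ (act P.H y))) = inner ℝ (P.output ζ) y := by
  rw [weight, inner_mulOp, output, kernelInt, real_inner_comm y, ← integral_inner
    (integrable_act P.continuousOn_K₁ ζ)]
  refine integral_congr_ae ?_
  filter_upwards [ae_mem_Icc, Lp.coeFn_const 2 μI (act P.H y)] with ξ hξ h
  have h' : (Lp.constL 2 μI ℝ (act P.H y) : L2) ξ = act P.H y := h
  rw [h', ← act_mul_apply, Q, Matrix.nonsing_inv_mul_cancel_right _ _
    ((Matrix.isUnit_iff_isUnit_det _).1 P.isUnit_H), ← inner_act_comm (P.isSymm_K₁ ξ hξ),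
    real_inner_comm]

theorem inner_source_le (h : P.SourceDissipativity) (y : R2) (ζ : L2) :
    inner ℝ (P.source y ζ) (P.weight ζ) ≤ inner ℝ (P.output ζ) y := by
  have h1 : inner ℝ ζ (P.weight (compLpB (act (P.Sig y)) (P.addMean ζ))) ≤ 0 := by
    rw [weight, inner_mulOp]
    refine le_of_eq_of_le (integral_congr_ae ?_) (h y ζ)
    have h2 : P.addMean ζ = ζ + Lp.const 2 μI (kernelInt P.K₂ ζ) := by
      rw [← kernelIntL_apply P.continuousOn_K₂]
      rfl
    filter_upwards [(act (P.Sig y)).coeFn_compLp' (P.addMean ζ),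
      Lp.coeFn_add ζ (Lp.const 2 μI (kernelInt P.K₂ ζ)),
      Lp.coeFn_const 2 μI (kernelInt P.K₂ ζ)] with ξ h3 h4 h5
    rw [compLpB_apply, h3, h2, h4, Pi.add_apply, h5, Function.const_apply]
  rw [← P.isInnerWeight_weight.symm, real_inner_comm, source_eq, map_add, map_smul,
    inner_add_right, real_inner_smul_right, inner_weight_const]
  linarith [mul_nonpos_of_nonneg_of_nonpos P.θ_nonneg h1]

variable {P} {ω : ℝ}

theorem exists_isMildSolution (hω : 0 < ω) (h₁ : P.StrictDissipativity ω) {T : ℝ} (z₀ : L2)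
    {v : ℝ → R2} (hT : 0 < T) (hv : ContinuousOn v (Icc 0 T)) :
    ∃ z : ℝ → L2, P.IsMildSolution T z₀ v z := by
  have hB := P.isInnerWeight_weight
  have hA := isMaxDissipative_isA hω h₁
  obtain ⟨S, hS, hG⟩ := hA.exists_semigroup hB
  obtain ⟨M, hM, hMB⟩ := hB.exists_norm_le
  have hSM : ∀ t, 0 ≤ t → ∀ x, ‖S t x‖ ≤ M * ‖x‖ := fun t ht x =>
    hMB _ _ (hS.energy_nonincreasing hB hG (hA.dense_domain hB) hω.le
      (fun _ _ h => h₁.inner_le P.continuousOn_Q h) ht x)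
  obtain ⟨v', hv', hvv, hvr⟩ := exists_continuous_extension hT.le hv
  -- Bounding `Σ(v(s))` on the compact interval makes the Lipschitz constant in `ζ` independent of
  -- time.
  obtain ⟨C, hC⟩ := isCompact_Icc.exists_bound_of_continuousOn
    ((continuous_act.comp P.continuous_Sig).comp_continuousOn hv)
  have hC0 : 0 ≤ C := (norm_nonneg _).trans (hC 0 ⟨le_rfl, hT.le⟩)
  have hθ := P.θ_nonneg
  let G : ℝ → L2 → L2 := fun s ζ => P.source (v' s) ζ
  have hGc : Continuous fun p : ℝ × L2 => G p.1 p.2 :=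
    P.continuous_source (hv'.comp continuous_fst) continuous_snd
  have hGL : ∀ s x y, ‖G s x - G s y‖ ≤ P.θ * (‖compLpB‖ * C * ‖P.addMean‖) * ‖x - y‖ := by
    intro s x y
    obtain ⟨r, hr, hvr⟩ := hvr s
    have h : ‖act (P.Sig (v' s))‖ ≤ C := by
      rw [hvr]
      exact hC r hr
    refine (P.norm_source_sub_le _ _ _).trans ?_
    gcongr
  have hL0 : 0 ≤ P.θ * (‖compLpB‖ * C * ‖P.addMean‖) := by positivity
  obtain ⟨z, hz, hz'⟩ := exists_eq_duhamel (zero_le_one.trans hM) (hS.continuous_apply hSM) hSM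
    hGc hL0 hGL hT.le z₀
  refine ⟨z, hz.continuousOn, S, ⟨hS.zero, hS.add, hS.continuousOn⟩, hG, fun t ht => ?_⟩
  rw [hz' t ht, duhamel, max_eq_left ht.1]
  congr 1
  refine intervalIntegral.integral_congr fun s hs => ?_
  rw [uIcc_of_le ht.1] at hs
  rw [max_eq_left (sub_nonneg.2 hs.2)]
  simp only [G]
  rw [hvv s ⟨hs.1, hs.2.trans ht.2⟩]

/-- Half of the energy inequality, applied to the semigroup that the mild solution itself carries,
so uniqueness of the semigroup plays no role. -/
theorem IsMildSolution.passivity (hω : 0 < ω) (h₁ : P.StrictDissipativity ω)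
    (h₂ : P.SourceDissipativity) {T : ℝ} {z₀ : L2} {v : ℝ → R2} {z : ℝ → L2} (hT : 0 < T)
    (hv : ContinuousOn v (Icc 0 T)) (hz : P.IsMildSolution T z₀ v z) {t : ℝ} (ht : t ∈ Icc 0 T) :
    P.storage (z t) - P.storage z₀ + ω * ∫ s in (0 : ℝ)..t, ‖z s‖ ^ 2 ≤
      ∫ s in (0 : ℝ)..t, inner ℝ (P.output (z s)) (v s) := by
  have hB := P.isInnerWeight_weight
  have hA := isMaxDissipative_isA hω h₁
  obtain ⟨hzc, S, hS, hG, hzS⟩ := hz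
  have hS' : IsContSemigroup S := ⟨hS.zero, hS.add, hS.continuousOn⟩
  obtain ⟨v', hv', hvv, -⟩ := exists_continuous_extension hT.le hv
  obtain ⟨z', hz', hzz, -⟩ := exists_continuous_extension hT.le hzc
  have hf : Continuous fun s => P.source (v' s) (z' s) :=
    P.continuous_source hv' hz'
  -- With the source frozen along the solution, `z` solves a linear inhomogeneous problem on
  -- `[0,T]`.
  have hd : ∀ s ∈ Icc 0 T, duhamel S z₀ (fun s => P.source (v' s) (z' s)) s = z' s := by
    intro s hs
    rw [hzz s hs, hzS s hs, duhamel, max_eq_left hs.1]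
    congr 1
    refine intervalIntegral.integral_congr fun τ hτ => ?_
    rw [uIcc_of_le hs.1] at hτ
    have hτ' : τ ∈ Icc 0 T := ⟨hτ.1, hτ.2.trans hs.2⟩
    rw [max_eq_left (sub_nonneg.2 hτ.2), hvv τ hτ', hzz τ hτ']
  have key := hS'.energy_duhamel_le hB hG (hA.dense_domain hB) hω.le
      (fun _ _ h => h₁.inner_le P.continuousOn_Q h) z₀ hf ht.1
  have hsub : ∀ s ∈ Icc 0 t, s ∈ Icc 0 T := fun s hs => ⟨hs.1, hs.2.trans ht.2⟩
  have hout : Continuous fun s => inner ℝ (P.output (z' s)) (v' s) :=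
    (P.continuous_output.comp hz').inner hv'
  have hmono : ∫ s in (0 : ℝ)..t,
      (-(2 * ω) * ‖duhamel S z₀ (fun s => P.source (v' s) (z' s)) s‖ ^ 2 +
        2 * inner ℝ (P.source (v' s) (z' s))
          (P.weight (duhamel S z₀ (fun s => P.source (v' s) (z' s)) s))) ≤
      ∫ s in (0 : ℝ)..t, (-(2 * ω) * ‖z' s‖ ^ 2 + 2 * inner ℝ (P.output (z' s)) (v' s)) := by
    rw [intervalIntegral.integral_congr (g := fun s => -(2 * ω) * ‖z' s‖ ^ 2 +
      2 * inner ℝ (P.source (v' s) (z' s)) (P.weight (z' s)))]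
    · refine intervalIntegral.integral_mono_on ht.1
        (Continuous.intervalIntegrable (by fun_prop) _ _)
        (Continuous.intervalIntegrable (by fun_prop) _ _) fun s _ => ?_
      have := P.inner_source_le h₂ (v' s) (z' s)
      linarith
    · intro s hs
      rw [uIcc_of_le ht.1] at hs
      beta_reduce
      rw [hd s (hsub s hs)]
  have hsplit : ∫ s in (0 : ℝ)..t,
      (-(2 * ω) * ‖z' s‖ ^ 2 + 2 * inner ℝ (P.output (z' s)) (v' s)) =
      -(2 * ω) * (∫ s in (0 : ℝ)..t, ‖z' s‖ ^ 2) +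
        2 * ∫ s in (0 : ℝ)..t, inner ℝ (P.output (z' s)) (v' s) := by
    rw [intervalIntegral.integral_add (Continuous.intervalIntegrable (by fun_prop) _ _)
      (Continuous.intervalIntegrable (by fun_prop) _ _), intervalIntegral.integral_const_mul,
      intervalIntegral.integral_const_mul]
  rw [hd t ht, hzz t ht] at key
  have e1 : ∫ s in (0 : ℝ)..t, ‖z s‖ ^ 2 = ∫ s in (0 : ℝ)..t, ‖z' s‖ ^ 2 :=
    intervalIntegral.integral_congr fun s hs => by
      rw [uIcc_of_le ht.1] at hs
      rw [hzz s (hsub s hs)]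
  have e2 : ∫ s in (0 : ℝ)..t, inner ℝ (P.output (z s)) (v s) =
      ∫ s in (0 : ℝ)..t, inner ℝ (P.output (z' s)) (v' s) :=
    intervalIntegral.integral_congr fun s hs => by
      rw [uIcc_of_le ht.1] at hs
      rw [hzz s (hsub s hs), hvv s (hsub s hs)]
  rw [e1, e2, storage_eq, storage_eq]
  linarith

end TransportSystem

end TirePDE

end

theorem mainTheorem3 (P : TirePDE.TransportSystem) (ω : ℝ) (hω : 0 < ω)
    (h₁ : P.StrictDissipativity ω)
    (h₂ : P.SourceDissipativity) (h₃ : P.SourceLipschitz) :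
    (∀ (T : ℝ) (z₀ : TirePDE.L2) (v : ℝ → TirePDE.R2), 0 < T → ContinuousOn v (Set.Icc 0 T) →
      ∃ z : ℝ → TirePDE.L2, P.IsMildSolution T z₀ v z) ∧
    P.IsStrictlyPassive P.storage ω :=
  ⟨fun _ z₀ _ hT hv => TirePDE.TransportSystem.exists_isMildSolution hω h₁ z₀ hT hv,
    { rate_pos := hω
      storage_nonneg := fun ζ => by
        rw [P.storage_eq]
        linarith [P.isInnerWeight_weight.energy_nonneg ζ]
      storage_zero := by simp [P.storage_eq]
      passivity := fun _ _ _ _ hT hv hz _ ht => hz.passivity hω h₁ h₂ hT hv ht }⟩
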